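/- Theorem 2.3. Let $\Gamma$ be a finite set with more than one element, and let $\mathcal D$ be the Dyck inverse monoid, that is, the monoid with zero generated by $\gamma(-),\gamma(+)$, $\gamma\in\Gamma$, with the relations $\gamma(-)\gamma(+)=\mathbf 1$ and $\gamma(-)\gamma'(+)=0$ for $\gamma\neq\gamma'$. Let $G_\circ$ be a finite directed graph (loops and parallel edges allowed) in which every vertex can be reached from every vertex by a possibly empty path (so one vertex without edges is allowed), with edges labeled by a finite alphabet $\Sigma_\circ$ such that at every vertex at most one outgoing edge carries a given label. Let $v_\circ$ be a vertex of $G_\circ$ and let $K_\gamma^-,K_\gamma^+\ge 1$, $\gamma\in\Gamma$, be integers. Let $G$ be the labeled graph obtained from $G_\circ$ by attaching at $v_\circ$ loops $e(\gamma(-),k)$, $1\le k\le K_\gamma^-$, and $e(\gamma(+),k)$, $1\le k\le K_\gamma^+$, $\gamma\in\Gamma$, that are labeled by themselves (these labels are distinct and not in $\Sigma_\circ$). Set $\varphi(\sigma)=\mathbf 1$ for $\sigma\in\Sigma_\circ$, $\varphi(e(\gamma(-),k))=\gamma(-)$ and $\varphi(e(\gamma(+),k))=\gamma(+)$. A finite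 path in $G$ is called admissible if the product in $\mathcal D$ of the values of $\varphi$ at its successive labels is not $0$. Let $X$ be the subshift of all two-sided sequences all of whose finite subwords are label sequences of admissible paths in $G$, and let $Y^0$ be the set of label sequences of the two-sided infinite paths in $G_\circ$. For a shift invariant set $Y$ of two-sided sequences over a finite alphabet let $\zeta_Y(z)=\exp\big(\sum_{n\ge1}\frac1n\operatorname{card}(P_n(Y))z^n\big)$, where $P_n(Y)$ is the set of points $x\in Y$ with $x_{i+n}=x_i$ for all $i\in\mathbb Z$. Let $g(\mathcal R,z)=\sum_{n\ge0}r_nz^n$, where $r_n$ is the number of paths of length $n$ in $G_\circ$ that start and end at $v_\circ$ (with $r_0=1$ for the empty path). Let $A$ be the adjacency matrix of $G_\circ$, whose entries count edges, and let $(\mathbf 1-Az)^{\langle v_\circ\rangle}$ be $\mathbf 1-Az$ with the row and the column of $v_\circ$ deleted (the determinant of an empty matrix is $1$). Put $$K_-=\sum_{\gamma\in\Gamma}K_\gamma^-,\qquad K_+=\sum_{\gamma\in\Gamma}K_\gamma^+,\qquad K=\sum_{\gamma\in\Gamma}K_\gamma^-K_\gamma^+ .$$ Then, as identities of formal power series over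 $\mathbb Q$, where $\sqrt{1-4Kg(\mathcal R,z)^2z^2}$ is the power series with constant term $1$ whose square is $1-4Kg(\mathcal R,z)^2z^2$, $$g(\mathcal R,z)=\frac{\det\big((\mathbf 1-Az)^{\langle v_\circ\rangle}\big)}{\det(\mathbf 1-Az)}$$ and $$\zeta_X(z)=\frac{2\,\zeta_{Y^0}(z)\big(1+\sqrt{1-4Kg(\mathcal R,z)^2z^2}\big)}{\big(1-2K_-g(\mathcal R,z)z+\sqrt{1-4Kg(\mathcal R,z)^2z^2}\big)\big(1-2K_+g(\mathcal R,z)z+\sqrt{1-4Kg(\mathcal R,z)^2z^2}\big)} .$$ -/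

import Mathlib

open PowerSeries

/-! ### Shift invariant sets and generating functions -/

/-- The shift on two-sided sequences. -/
def shiftMap {A : Type*} (x : ℤ → A) : ℤ → A := fun i => x (i + 1)

/-- The number of points of `Y` that have period `n` (not necessarily least period). -/
noncomputable def periodicCount {A : Type*} (Y : Set (ℤ → A)) (n : ℕ) : ℕ :=
  (Y ∩ Function.ptsOfPeriod shiftMap n).ncard

/-- The zeta function `exp (∑_{n ≥ 1} card (P_n Y) z ^ n / n)` as a formal power series. The
coefficient of the exponent at `n = 0` is `_ / 0 = 0`. -/
noncomputable def zetaSeries {A : Type*} (Y : Set (ℤ → A)) : ℚ⟦X⟧ :=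
  (PowerSeries.exp ℚ).subst (PowerSeries.mk fun n => (periodicCount Y n : ℚ) / (n : ℚ))

/-- The generating function of a formal language: the coefficient at `n` is the number of words
of length `n`. -/
noncomputable def languageSeries {A : Type*} (L : Language A) : ℚ⟦X⟧ :=
  PowerSeries.mk fun n => ({w : List A | w ∈ L ∧ w.length = n}.ncard : ℚ)

/-- The square root of a formal power series `f` with constant term `1`, given by the binomial
series `∑ (1/2 choose n) (f - 1) ^ n`. -/
noncomputable def sqrtSeries (f : ℚ⟦X⟧) : ℚ⟦X⟧ :=
  (PowerSeries.binomialSeries ℚ (1 / 2 : ℚ)).subst (f - 1)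

/-- For constant term `1`, `sqrtSeries f` is a square root of `f` with constant term `1`. -/
theorem sqrtSeries_spec (f : ℚ⟦X⟧) (hf : constantCoeff f = 1) :
    sqrtSeries f ^ 2 = f ∧ constantCoeff (sqrtSeries f) = 1 := by
  have hc : constantCoeff (f - 1) = 0 := by simp [hf]
  have hs : PowerSeries.HasSubst (f - 1) := PowerSeries.HasSubst.of_constantCoeff_zero' hc
  constructor
  · have h1 : PowerSeries.binomialSeries ℚ (1 / 2 : ℚ) ^ 2 = 1 + (X : ℚ⟦X⟧) := by
      rw [sq, ← PowerSeries.binomialSeries_add]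
      have := PowerSeries.binomialSeries_nat (R := ℚ) (A := ℚ) 1
      norm_num at this ⊢
      exact this
    rw [sqrtSeries, ← PowerSeries.subst_pow hs, h1, PowerSeries.subst_add hs,
      PowerSeries.subst_X hs, ← PowerSeries.coe_substAlgHom hs, map_one]
    ring
  · have h2 := PowerSeries.constantCoeff_subst_eq_zero (S := ℚ) hc
      (PowerSeries.binomialSeries ℚ (1 / 2 : ℚ) - 1) (by simp)
    rw [PowerSeries.subst_sub hs, ← PowerSeries.coe_substAlgHom hs, map_one] at h2
    rw [PowerSeries.coe_substAlgHom hs] at h2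
    change constantCoeff _ = 0 at h2
    rw [map_sub, map_one, sub_eq_zero] at h2
    exact h2

/-! ### The Dyck inverse monoid -/

/-- The generators `γ(-)` and `γ(+)`. -/
inductive DyckGen (Γ : Type*) where
  | neg (γ : Γ) : DyckGen Γ
  | pos (γ : Γ) : DyckGen Γ

/-- The defining relations, between elements of the free monoid with zero:
`γ(-) γ(+) = 1`, and `γ(-) γ'(+) = 0` for `γ ≠ γ'`. -/
inductive DyckRel (Γ : Type*) :
    WithZero (FreeMonoid (DyckGen Γ)) → WithZero (FreeMonoid (DyckGen Γ)) → Prop where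
  | cancel (γ : Γ) :
      DyckRel Γ (((FreeMonoid.of (DyckGen.neg γ) * FreeMonoid.of (DyckGen.pos γ) :
        FreeMonoid (DyckGen Γ))) : WithZero (FreeMonoid (DyckGen Γ))) 1
  | clash (γ γ' : Γ) (h : γ ≠ γ') :
      DyckRel Γ (((FreeMonoid.of (DyckGen.neg γ) * FreeMonoid.of (DyckGen.pos γ') :
        FreeMonoid (DyckGen Γ))) : WithZero (FreeMonoid (DyckGen Γ))) 0

/-- The Dyck inverse monoid (polycyclic monoid): the monoid with zero generated by the `γ(-)` and
`γ(+)` subject to the relations `DyckRel`. -/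
abbrev DyckMonoid (Γ : Type*) := (conGen (DyckRel Γ)).Quotient

/-- The class in the Dyck monoid of an element of the free monoid with zero. -/
def DyckMonoid.mk {Γ : Type*} : WithZero (FreeMonoid (DyckGen Γ)) →* DyckMonoid Γ :=
  (conGen (DyckRel Γ)).mk'

/-- The generators as elements of the Dyck monoid. -/
def DyckMonoid.of {Γ : Type*} (g : DyckGen Γ) : DyckMonoid Γ :=
  DyckMonoid.mk ((FreeMonoid.of g : FreeMonoid (DyckGen Γ)) : WithZero (FreeMonoid (DyckGen Γ)))

/-- The zero of the Dyck monoid. -/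
def DyckMonoid.zero (Γ : Type*) : DyckMonoid Γ := DyckMonoid.mk 0

/-! ### Labeled directed graphs -/

/-- A directed graph (parallel edges and loops allowed) with vertices `V` and edges `E`, labeled
by symbols in `S`. -/
structure LabeledGraph (V E S : Type*) where
  source : E → V
  target : E → V
  label : E → S

namespace LabeledGraph

/-- `G.IsPath u p w`: the edges listed in `p` form a path from `u` to `w`. The empty list is a path
from every vertex to itself. -/
def IsPath {V E S : Type*} (G : LabeledGraph V E S) : V → List E → V → Prop
  | u, [], w => u = w
  | u, e :: p, w => G.source e = u ∧ G.IsPath (G.target e) p w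

/-- Every vertex can be reached from every vertex. The graph with one vertex and no edges is
irreducible in this sense. -/
def Irreducible {V E S : Type*} (G : LabeledGraph V E S) : Prop :=
  ∀ u w : V, ∃ p : List E, G.IsPath u p w

/-- The labeling is 1-right resolving: at every vertex at most one outgoing edge carries a given
label. -/
def RightResolving {V E S : Type*} (G : LabeledGraph V E S) : Prop :=
  ∀ e e' : E, G.source e = G.source e' → G.label e = G.label e' → e = e'

/-- The adjacency matrix: entries count edges. -/
noncomputable def adjacency {V E S : Type*} (G : LabeledGraph V E S) : Matrix V V ℚ :=
  Matrix.of fun u w => ({e : E | G.source e = u ∧ G.target e = w}.ncard : ℚ)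

/-- The matrix `1 - A z` over formal power series. -/
noncomputable def oneSubAdjacency {V E S : Type*} [DecidableEq V] (G : LabeledGraph V E S) :
    Matrix V V ℚ⟦X⟧ :=
  1 - (X : ℚ⟦X⟧) • G.adjacency.map (PowerSeries.C : ℚ →+* ℚ⟦X⟧)

/-- The set of paths that start and end at `v`, including the empty path. -/
def returnPaths {V E S : Type*} (G : LabeledGraph V E S) (v : V) : Language E :=
  {p : List E | G.IsPath v p v}

/-- The sofic shift presented by `G`: the label sequences of its two-sided infinite paths. -/
def soficShift {V E S : Type*} (G : LabeledGraph V E S) : Set (ℤ → S) :=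
  {x | ∃ p : ℤ → E, (∀ i, G.target (p i) = G.source (p (i + 1))) ∧ ∀ i, x i = G.label (p i)}

end LabeledGraph

/-! ### Attaching loops that imitate the Dyck monoid -/

/-- The loops `e(γ(-), k)`, `1 ≤ k ≤ Kneg γ`, and `e(γ(+), k)`, `1 ≤ k ≤ Kpos γ` (the index `k`
is counted from `0` here). -/
inductive DyckLoop {Γ : Type*} (Kneg Kpos : Γ → ℕ) where
  | neg (γ : Γ) (k : Fin (Kneg γ)) : DyckLoop Kneg Kpos
  | pos (γ : Γ) (k : Fin (Kpos γ)) : DyckLoop Kneg Kpos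

/-- The graph obtained from `G` by attaching the loops `DyckLoop Kneg Kpos` to the vertex `v`, each
labeled by itself. -/
def LabeledGraph.attachLoops {V E S Γ : Type*} (G : LabeledGraph V E S) (v : V)
    (Kneg Kpos : Γ → ℕ) :
    LabeledGraph V (E ⊕ DyckLoop Kneg Kpos) (S ⊕ DyckLoop Kneg Kpos) where
  source := Sum.elim G.source fun _ => v
  target := Sum.elim G.target fun _ => v
  label := Sum.map G.label id

/-- The map `φ` from the symbols to the symbols `1, γ(-), γ(+)` of the Motzkin shift, seen as
elements of the Dyck monoid. -/
def motzkinValue {S Γ : Type*} {Kneg Kpos : Γ → ℕ} :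
    S ⊕ DyckLoop Kneg Kpos → DyckMonoid Γ
  | Sum.inl _ => 1
  | Sum.inr (DyckLoop.neg γ _) => DyckMonoid.of (DyckGen.neg γ)
  | Sum.inr (DyckLoop.pos γ _) => DyckMonoid.of (DyckGen.pos γ)

/-- A word over the symbols is mapped by `φ` to an admissible word of the Motzkin shift: the product
of the values in the Dyck monoid does not vanish. -/
def MotzkinAdmissible {S Γ : Type*} {Kneg Kpos : Γ → ℕ} (w : List (S ⊕ DyckLoop Kneg Kpos)) :
    Prop :=
  (w.map motzkinValue).prod ≠ DyckMonoid.zero Γ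

/-- The label sequences of the admissible paths in the graph with attached loops. -/
def LabeledGraph.attachedLanguage {V E S Γ : Type*} (G : LabeledGraph V E S) (v : V)
    (Kneg Kpos : Γ → ℕ) : Language (S ⊕ DyckLoop Kneg Kpos) :=
  {w | ∃ (u u' : V) (p : List (E ⊕ DyckLoop Kneg Kpos)),
    (G.attachLoops v Kneg Kpos).IsPath u p u' ∧
      p.map (G.attachLoops v Kneg Kpos).label = w ∧ MotzkinAdmissible w}

/-- The subshift of the construction: the two-sided sequences all of whose finite words are label
sequences of admissible paths. -/
def LabeledGraph.attachedShift {V E S Γ : Type*} (G : LabeledGraph V E S) (v : V)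
    (Kneg Kpos : Γ → ℕ) : Set (ℤ → S ⊕ DyckLoop Kneg Kpos) :=
  {x | ∀ (i : ℤ) (n : ℕ),
    (List.ofFn fun j : Fin n => x (i + (j : ℕ))) ∈ G.attachedLanguage v Kneg Kpos}

section

open scoped Computability

/-! A point of period `n` is a word of length `n` all of whose powers are labels of admissible
paths. If no attached loop occurs in it, it is a periodic word of the sofic shift of `G`. Otherwise
some rotation starts with a loop, hence reads a closed path at `v`: a concatenation of loop symbols,
each followed by a return word of `G`. Nonvanishing in the Dyck monoid puts such a word into the
form `p ++ m ++ n`, where `p` has uncancelled symbols `γ(+)`, `m` is neutral (value `1`) and `n` has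
uncancelled symbols `γ(-)` (`exists_normal_form`). Rotating further, the ends of the word cancel
against each other until only one kind is left (`isRotated_normal_form_aux`). So the word is a
rotation of an element of `C∗` for one of three codes: `posCode`, `balancedCode`, `negCode`. The
sign of `height` tells the three apart (`periodicCount_attachedShift_eq_add`).

Each of the three codes, or its mirror image, is circular: a rotated concatenation of codewords
determines its cut. With `c` the generating function of the code, the rotations are therefore
counted by `X c' / (1 - c)` (`IsCircularCode.languageSeries_rotations`), and exponentiation gives
the factor `1 / (1 - c)` of the zeta function. This is `zetaSeries_attachedShift`.

Let `M` count the neutral words and let `c` now belong to `balancedCode`. Then the other two codes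
have series `K₋ X M` and `K₊ X M`, while `c = K X² M g` and `M (1 - c) = g`. Hence `c (1 - c) = K g²
X²`, so `1 - 2c` is the required square root, and the product of three factors takes the asserted
form. Right resolution identifies return words with return paths; these are counted by a diagonal
entry of `(1 - A z)⁻¹`, that is, by a cofactor over the determinant. -/

/-! ### Exponentials and square roots of formal power series -/

theorem constantCoeff_exp_subst {f : ℚ⟦X⟧} (hf : constantCoeff f = 0) :
    constantCoeff ((PowerSeries.exp ℚ).subst f) = 1 := by
  have hs : PowerSeries.HasSubst f := PowerSeries.HasSubst.of_constantCoeff_zero' hf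
  have h := PowerSeries.constantCoeff_subst_eq_zero (S := ℚ) hf (PowerSeries.exp ℚ - 1) (by simp)
  rw [← PowerSeries.coe_substAlgHom hs, map_sub, map_one, PowerSeries.coe_substAlgHom hs] at h
  change constantCoeff _ = 0 at h
  rwa [map_sub, map_one, sub_eq_zero] at h

theorem derivative_exp_subst {f : ℚ⟦X⟧} (hf : constantCoeff f = 0) :
    d⁄dX ℚ ((PowerSeries.exp ℚ).subst f) = (PowerSeries.exp ℚ).subst f * d⁄dX ℚ f := by
  rw [PowerSeries.derivative_subst (PowerSeries.HasSubst.of_constantCoeff_zero' hf),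
    PowerSeries.derivative_exp]

/-- A power series with constant term `1` is determined by its logarithmic derivative. -/
theorem eq_exp_subst_of_derivative {f F : ℚ⟦X⟧} (hf : constantCoeff f = 0)
    (hF : constantCoeff F = 1) (hD : d⁄dX ℚ F = F * d⁄dX ℚ f) :
    F = (PowerSeries.exp ℚ).subst f := by
  set G := (PowerSeries.exp ℚ).subst f with hG
  have hG1 : constantCoeff G = 1 := constantCoeff_exp_subst hf
  have hG0 : G ≠ 0 := by rintro h; simp [h] at hG1
  have hGD : d⁄dX ℚ G = G * d⁄dX ℚ f := derivative_exp_subst hf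
  have hGi : G * G⁻¹ = 1 := PowerSeries.mul_inv_cancel _ (by simp [hG1])
  have h1 : F * G⁻¹ = 1 := by
    apply PowerSeries.derivative.ext
    · rw [Derivation.leibniz, PowerSeries.derivative_inv', hD, hGD]
      simp only [smul_eq_mul, PowerSeries.derivative_one]
      linear_combination (-(F * G⁻¹ * d⁄dX ℚ f)) * hGi
    · simp [hF, hG1]
  calc F = F * (G * G⁻¹) := by rw [hGi, mul_one]
    _ = G := by rw [mul_comm G, ← mul_assoc, h1, one_mul]

theorem exp_subst_add {a b : ℚ⟦X⟧} (ha : constantCoeff a = 0) (hb : constantCoeff b = 0) :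
    (PowerSeries.exp ℚ).subst (a + b) =
      (PowerSeries.exp ℚ).subst a * (PowerSeries.exp ℚ).subst b := by
  symm
  apply eq_exp_subst_of_derivative
  · simp [ha, hb]
  · simp [constantCoeff_exp_subst ha, constantCoeff_exp_subst hb]
  · rw [Derivation.leibniz, derivative_exp_subst ha, derivative_exp_subst hb, map_add]
    simp only [smul_eq_mul]
    ring

/-- If `f` has the derivative of `-log (1 - c)`, then `exp f = 1 / (1 - c)`. -/
theorem exp_subst_mul_one_sub {f c : ℚ⟦X⟧} (hf : constantCoeff f = 0) (hc : constantCoeff c = 0)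
    (h : X * d⁄dX ℚ f * (1 - c) = X * d⁄dX ℚ c) :
    (PowerSeries.exp ℚ).subst f * (1 - c) = 1 := by
  have h' : d⁄dX ℚ f * (1 - c) = d⁄dX ℚ c :=
    mul_left_cancel₀ (PowerSeries.X_ne_zero (R := ℚ)) (by rw [← mul_assoc, h])
  apply PowerSeries.derivative.ext
  · rw [Derivation.leibniz, derivative_exp_subst hf, map_sub]
    simp only [smul_eq_mul, PowerSeries.derivative_one]
    linear_combination ((PowerSeries.exp ℚ).subst f) * h'
  · simp [constantCoeff_exp_subst hf, hc]

/-- The exponent of the zeta function of a sequence of numbers of periodic points. -/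
noncomputable def zetaExponent (p : ℕ → ℕ) : ℚ⟦X⟧ :=
  PowerSeries.mk fun n => (p n : ℚ) / (n : ℚ)

theorem constantCoeff_zetaExponent (p : ℕ → ℕ) : constantCoeff (zetaExponent p) = 0 := by
  rw [← PowerSeries.coeff_zero_eq_constantCoeff_apply]
  simp [zetaExponent]

/-- The division by `n` in the exponent undoes the factor from differentiation. At `n = 0` the left
side vanishes whatever `p 0` is, which is why `h0` appears. -/
theorem X_mul_derivative_zetaExponent (p : ℕ → ℕ) (h0 : p 0 = 0) :
    X * d⁄dX ℚ (zetaExponent p) = PowerSeries.mk fun n => (p n : ℚ) := by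
  ext n
  cases n with
  | zero => simp [h0]
  | succ n =>
    rw [PowerSeries.coeff_succ_X_mul, PowerSeries.coeff_derivative]
    simp only [zetaExponent, PowerSeries.coeff_mk]
    push_cast
    field_simp

/-- Square roots with constant term `1` are unique. -/
theorem eq_sqrtSeries {f t : ℚ⟦X⟧} (ht : t ^ 2 = f) (h1 : constantCoeff t = 1) :
    t = sqrtSeries f := by
  have hf : constantCoeff f = 1 := by rw [← ht]; simp [h1]
  obtain ⟨hs, hs1⟩ := sqrtSeries_spec f hf
  rcases sq_eq_sq_iff_eq_or_eq_neg.1 (ht.trans hs.symm) with h | h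
  · exact h
  · have := congrArg constantCoeff h
    rw [map_neg, h1, hs1] at this
    norm_num at this

/-! ### Generating functions of types with a size -/

/-- The generating function of a type with a size function. -/
noncomputable def sizeSeries {τ : Type*} (size : τ → ℕ) : ℚ⟦X⟧ :=
  PowerSeries.mk fun n => (Nat.card {t // size t = n} : ℚ)

theorem languageSeries_eq_sizeSeries {A : Type*} (L : Language A) :
    languageSeries L = sizeSeries fun w : {w : List A // w ∈ L} => w.1.length := by
  ext n
  simp only [languageSeries, sizeSeries, PowerSeries.coeff_mk, Nat.cast_inj]
  rw [← Nat.card_coe_set_eq]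
  exact Nat.card_congr (Equiv.subtypeSubtypeEquivSubtypeInter (· ∈ L) (·.length = n)).symm

theorem finite_word_fiber {A : Type*} [Finite A] (L : Language A) (n : ℕ) :
    Finite {w : {w : List A // w ∈ L} // w.1.length = n} :=
  have := (List.finite_length_eq A n).to_subtype
  Finite.of_injective (β := {w : List A | w.length = n})
    (fun w => ⟨w.1.1, w.2⟩) fun a b h => by
      apply Subtype.ext
      apply Subtype.ext
      simpa using h

theorem sizeSeries_congr {α β : Type*} {f : α → ℕ} {g : β → ℕ} (e : α → β)
    (he : Function.Bijective e) (h : ∀ a, g (e a) = f a) : sizeSeries f = sizeSeries g := by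
  ext n
  simp only [sizeSeries, PowerSeries.coeff_mk, Nat.cast_inj]
  exact Nat.card_congr ((Equiv.ofBijective e he).subtypeEquiv fun a => by
    simp [Equiv.ofBijective_apply, h])

theorem sizeSeries_prod {α β : Type*} (f : α → ℕ) (g : β → ℕ)
    [∀ n, Finite {a // f a = n}] [∀ n, Finite {b // g b = n}] :
    sizeSeries (fun p : α × β => f p.1 + g p.2) = sizeSeries f * sizeSeries g := by
  ext n
  rw [PowerSeries.coeff_mul]
  simp only [sizeSeries, PowerSeries.coeff_mk]
  let e : {p : α × β // f p.1 + g p.2 = n} ≃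
      Σ q : {q // q ∈ Finset.HasAntidiagonal.antidiagonal n},
        {a // f a = q.1.1} × {b // g b = q.1.2} :=
    { toFun := fun p => ⟨⟨(f p.1.1, g p.1.2), Finset.HasAntidiagonal.mem_antidiagonal.2 p.2⟩,
        ⟨p.1.1, rfl⟩, ⟨p.1.2, rfl⟩⟩
      invFun := fun q => ⟨(q.2.1.1, q.2.2.1), by
        rw [q.2.1.2, q.2.2.2]; exact Finset.HasAntidiagonal.mem_antidiagonal.1 q.1.2⟩
      left_inv := fun p => rfl
      right_inv := by
        rintro ⟨⟨⟨i, j⟩, hq⟩, ⟨a, h1⟩, ⟨b, h2⟩⟩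
        have h1' : i = f a := h1.symm
        have h2' : j = g b := h2.symm
        subst h1' h2'
        rfl }
  rw [Nat.card_congr e, Nat.card_sigma]
  simp only [Nat.card_prod]
  push_cast
  exact Finset.sum_coe_sort (Finset.HasAntidiagonal.antidiagonal n)
    (fun q => (Nat.card {a // f a = q.1} : ℚ) * Nat.card {b // g b = q.2})

theorem sizeSeries_sum {α β : Type*} (f : α → ℕ) (g : β → ℕ)
    [∀ n, Finite {a // f a = n}] [∀ n, Finite {b // g b = n}] :
    sizeSeries (Sum.elim f g) = sizeSeries f + sizeSeries g := by
  ext n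
  rw [map_add]
  simp only [sizeSeries, PowerSeries.coeff_mk]
  have : Finite {a // Sum.elim f g (Sum.inl a) = n} := inferInstanceAs (Finite {a // f a = n})
  have : Finite {b // Sum.elim f g (Sum.inr b) = n} := inferInstanceAs (Finite {b // g b = n})
  rw [Nat.card_congr (Equiv.subtypeSum (p := fun x => Sum.elim f g x = n)), Nat.card_sum]
  simp

theorem sizeSeries_const {α : Type*} (k : ℕ) :
    sizeSeries (fun _ : α => k) = (Nat.card α : ℚ⟦X⟧) * X ^ k := by
  ext n
  rw [← map_natCast (PowerSeries.C (R := ℚ)), PowerSeries.coeff_C_mul, PowerSeries.coeff_X_pow]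
  simp only [sizeSeries, PowerSeries.coeff_mk]
  split_ifs with h
  · subst h
    simp only [mul_one, Nat.cast_inj]
    exact Nat.card_congr (Equiv.subtypeUnivEquiv fun _ => trivial)
  · have : IsEmpty {_a : α // k = n} := ⟨fun a => h a.2.symm⟩
    simp

/-- Marking one of the `f a` positions of an object multiplies the coefficient at `n` by `n`. The
mark will be the place where a rotation cuts a codeword. -/
theorem sizeSeries_sigma_fin {α : Type*} (f : α → ℕ) [∀ n, Finite {a // f a = n}] :
    sizeSeries (fun p : Σ a, Fin (f a) => f p.1) = X * d⁄dX ℚ (sizeSeries f) := by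
  have key : ∀ n, Nat.card {p : Σ a, Fin (f a) // f p.1 = n} = Nat.card {a // f a = n} * n := by
    intro n
    let e : {p : Σ a, Fin (f a) // f p.1 = n} ≃ {a // f a = n} × Fin n :=
      { toFun := fun p => (⟨p.1.1, p.2⟩, Fin.cast p.2 p.1.2)
        invFun := fun q => ⟨⟨q.1.1, Fin.cast q.1.2.symm q.2⟩, q.1.2⟩
        left_inv := fun p => rfl
        right_inv := fun q => rfl }
    rw [Nat.card_congr e, Nat.card_prod, Nat.card_fin]
  ext n
  cases n with
  | zero => simp [sizeSeries, key]
  | succ n =>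
    rw [PowerSeries.coeff_succ_X_mul, PowerSeries.coeff_derivative]
    simp only [sizeSeries, PowerSeries.coeff_mk, key]
    push_cast
    ring

instance finite_sigma_fin_fiber {α : Type*} (f : α → ℕ) [∀ n, Finite {a // f a = n}] (n : ℕ) :
    Finite {p : Σ a, Fin (f a) // f p.1 = n} :=
  Finite.of_injective (β := {a // f a = n} × Fin n)
    (fun p => (⟨p.1.1, p.2⟩, Fin.cast p.2 p.1.2)) (by
      rintro ⟨⟨a, i⟩, h⟩ ⟨⟨b, j⟩, h'⟩ e
      simp only [Prod.mk.injEq, Subtype.mk.injEq] at e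
      obtain ⟨rfl, e⟩ := e
      simpa [Fin.ext_iff] using e)

instance finite_prod_fiber {α β : Type*} (f : α → ℕ) (g : β → ℕ)
    [∀ n, Finite {a // f a = n}] [∀ n, Finite {b // g b = n}] (n : ℕ) :
    Finite {p : α × β // f p.1 + g p.2 = n} :=
  Finite.of_injective
    (β := Σ q : {q // q ∈ Finset.HasAntidiagonal.antidiagonal n},
      {a // f a = q.1.1} × {b // g b = q.1.2})
    (fun p => ⟨⟨(f p.1.1, g p.1.2), Finset.HasAntidiagonal.mem_antidiagonal.2 p.2⟩,
      ⟨p.1.1, rfl⟩, ⟨p.1.2, rfl⟩⟩)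
    (by
      intro p q h
      have h2 := congrArg (fun z => (z.2.1.1, z.2.2.1)) h
      exact Subtype.ext h2)

/-! ### Concatenations of codewords -/

section KStar
variable {A : Type*} {C : Language A}

theorem append_mem_kstar {u w : List A} (hu : u ∈ C∗) (hw : w ∈ C∗) : u ++ w ∈ C∗ := by
  obtain ⟨L, rfl, hL⟩ := hu
  obtain ⟨M, rfl, hM⟩ := hw
  exact ⟨L ++ M, by simp, fun y hy => (List.mem_append.1 hy).elim (hL y) (hM y)⟩

theorem mem_kstar_of_mem {u : List A} (hu : u ∈ C) : u ∈ C∗ :=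
  ⟨[u], by simp, by simpa using hu⟩

theorem kstar_induction {P : List A → Prop} (h0 : P [])
    (h1 : ∀ c ∈ C, ∀ r ∈ C∗, P r → P (c ++ r)) {w : List A} (hw : w ∈ C∗) : P w := by
  obtain ⟨L, rfl, hL⟩ := hw
  induction L with
  | nil => simpa using h0
  | cons c L ih =>
    rw [List.flatten_cons]
    have hL' : ∀ y ∈ L, y ∈ C := fun y hy => hL y (List.mem_cons_of_mem _ hy)
    exact h1 c (hL c List.mem_cons_self) _ ⟨L, rfl, hL'⟩ (ih hL')

theorem kstar_induction_right {P : List A → Prop} (h0 : P [])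
    (h1 : ∀ c ∈ C, ∀ r ∈ C∗, P r → P (r ++ c)) {w : List A} (hw : w ∈ C∗) : P w := by
  obtain ⟨L, rfl, hL⟩ := hw
  induction L using List.reverseRecOn with
  | nil => simpa using h0
  | append_singleton L c ih =>
    rw [List.flatten_append]
    have hL' : ∀ y ∈ L, y ∈ C := fun y hy => hL y (by simp [hy])
    simpa using h1 c (hL c (by simp)) _ ⟨L, rfl, hL'⟩ (ih hL')

theorem replicate_flatten_mem_kstar {w : List A} (hw : w ∈ C∗) (m : ℕ) :
    (List.replicate m w).flatten ∈ C∗ := by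
  induction m with
  | zero => exact Language.nil_mem_kstar C
  | succ m ih =>
    rw [List.replicate_succ, List.flatten_cons]
    exact append_mem_kstar hw ih

end KStar

/-! ### Circular codes and their rotations -/

/-- A code such that no proper nonempty suffix of a codeword is a prefix of a concatenation of
codewords. -/
structure IsCircularCode {A : Type*} (C : Language A) : Prop where
  nil_notMem : [] ∉ C
  suffix : ∀ a b r : List A, a ≠ [] → b ≠ [] → a ++ b ∈ C → b ++ r ∈ C∗ → False

/-- The nonempty words that have a rotation in `C∗`. -/
def rotations {A : Type*} (C : Language A) : Language A :=
  {w | w ≠ [] ∧ ∃ x y, w = y ++ x ∧ x ++ y ∈ C∗}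

namespace IsCircularCode
variable {A : Type*} {C : Language A}

/-- If the first codewords had different lengths, the longer one would end in a nonempty proper
suffix that begins a concatenation of codewords. -/
theorem append_cancel (hC : IsCircularCode C) {c c' r r' : List A} (hc : c ∈ C)
    (hc' : c' ∈ C) (hr : r ∈ C∗)
    (hr' : r' ∈ C∗) (h : c ++ r = c' ++ r') : c = c' ∧ r = r' := by
  have ne : ∀ c ∈ C, c ≠ [] := fun c hc h => hC.nil_notMem (h ▸ hc)
  rcases List.append_eq_append_iff.1 h with ⟨z, rfl, rfl⟩ | ⟨z, rfl, rfl⟩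
  · by_cases hz : z = []
    · simp [hz]
    · exact (hC.suffix c z r' (ne c hc) hz hc' hr).elim
  · by_cases hz : z = []
    · simp [hz]
    · exact (hC.suffix c' z r (ne c' hc') hz hc hr').elim

/-- A word of `C∗` is empty or, in exactly one way by `append_cancel`, a codeword followed by a word
of `C∗`. -/
theorem languageSeries_kstar (hC : IsCircularCode C) [Finite A] :
    languageSeries C∗ * (1 - languageSeries C) = 1 := by
  have := finite_word_fiber C
  have := finite_word_fiber C∗
  have := finite_prod_fiber (fun c : {w // w ∈ C} => c.1.length)
    (fun c : {w // w ∈ C∗} => c.1.length)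
  let e : Unit ⊕ ({w // w ∈ C} × {w // w ∈ C∗}) → {w // w ∈ C∗} :=
    Sum.elim (fun _ => ⟨[], Language.nil_mem_kstar C⟩)
      (fun p => ⟨p.1.1 ++ p.2.1, append_mem_kstar (mem_kstar_of_mem p.1.2) p.2.2⟩)
  have he : Function.Bijective e := by
    constructor
    · rintro (⟨⟩ | ⟨⟨c, hc⟩, ⟨r, hr⟩⟩) (⟨⟩ | ⟨⟨c', hc'⟩, ⟨r', hr'⟩⟩) h
      · rfl
      · have h := congrArg Subtype.val h
        simp only [e, Sum.elim_inl, Sum.elim_inr] at h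
        exact (hC.nil_notMem ((List.append_eq_nil_iff.1 h.symm).1 ▸ hc')).elim
      · have h := congrArg Subtype.val h
        simp only [e, Sum.elim_inl, Sum.elim_inr] at h
        exact (hC.nil_notMem ((List.append_eq_nil_iff.1 h).1 ▸ hc)).elim
      · have h := congrArg Subtype.val h
        simp only [e, Sum.elim_inr] at h
        obtain ⟨rfl, rfl⟩ := hC.append_cancel hc hc' hr hr' h
        rfl
    · rintro ⟨w, hw⟩
      refine kstar_induction (P := fun w => ∀ hw : w ∈ C∗, ∃ a, e a = ⟨w, hw⟩) ?_ ?_ hw hw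
      · exact fun _ => ⟨Sum.inl (), rfl⟩
      · exact fun c hc r hr _ _ => ⟨Sum.inr (⟨c, hc⟩, ⟨r, hr⟩), rfl⟩
  have h := sizeSeries_congr (f := Sum.elim (fun _ => 0) fun p => p.1.1.length + p.2.1.length)
    (g := fun w : {w // w ∈ C∗} => w.1.length) e he (by
      rintro (⟨⟩ | ⟨c, r⟩) <;> simp [e])
  rw [sizeSeries_sum (fun _ => 0) (fun p : {w // w ∈ C} × {w // w ∈ C∗} =>
      p.1.1.length + p.2.1.length), sizeSeries_prod (fun c : {w // w ∈ C} => c.1.length)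
      (fun c : {w // w ∈ C∗} => c.1.length), sizeSeries_const,
    ← languageSeries_eq_sizeSeries, ← languageSeries_eq_sizeSeries] at h
  simp only [Nat.card_unique, Nat.cast_one, pow_zero, mul_one] at h
  linear_combination -h

/-- The case in which one tail, `b`, is a prefix of the other, `b ++ z`. Every mismatch exhibits a
nonempty proper suffix of a codeword as a prefix of a word of `C∗`, against circularity. -/
theorem eq_of_rotation_eq_aux (hC : IsCircularCode C) {a b r a' z r' : List A} (hb : b ≠ [])
    (hc : a ++ b ∈ C) (hc' : a' ++ (b ++ z) ∈ C) (hr : r ∈ C∗) (hr' : r' ∈ C∗)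
    (h : r ++ a = z ++ r' ++ a') : a = a' ∧ z = [] ∧ r = r' := by
  have hw := append_mem_kstar (mem_kstar_of_mem hc) hr
  have hw' := append_mem_kstar (mem_kstar_of_mem hc') hr'
  rcases List.append_eq_append_iff.1 h with ⟨y, h1, h2⟩ | ⟨y, h1, h2⟩
  · have hy : y = [] := by
      by_contra hy
      refine hC.suffix y (a' ++ b) (z ++ r') hy (by simp [hb]) ?_ (by simpa using hw')
      simpa [h2] using hc
    subst hy
    have hz : z = [] := by
      by_contra hz
      refine hC.suffix (a' ++ b) z r' (by simp [hb]) hz (by simpa using hc') ?_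
      simpa [h1] using hr
    simp_all
  · have hz : z = [] := by
      by_contra hz
      refine hC.suffix (a' ++ b) z (r' ++ y) (by simp [hb]) hz (by simpa using hc') ?_
      simpa [h1] using hr
    subst hz
    have hy : y = [] := by
      by_contra hy
      refine hC.suffix y (a ++ b) r hy (by simp [hb]) ?_ hw
      simpa [h2] using hc'
    simp_all

/-- The offset of a rotated concatenation of codewords within its first codeword is unique. -/
theorem eq_of_rotation_eq (hC : IsCircularCode C) {a b r a' b' r' : List A}
    (hb : b ≠ []) (hb' : b' ≠ [])
    (hc : a ++ b ∈ C) (hc' : a' ++ b' ∈ C) (hr : r ∈ C∗) (hr' : r' ∈ C∗)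
    (h : b ++ (r ++ a) = b' ++ (r' ++ a')) : a = a' ∧ b = b' ∧ r = r' := by
  rcases List.append_eq_append_iff.1 h with ⟨z, rfl, h⟩ | ⟨z, rfl, h⟩
  · obtain ⟨rfl, rfl, rfl⟩ := hC.eq_of_rotation_eq_aux hb hc hc' hr hr' (by simpa using h)
    simp
  · obtain ⟨rfl, rfl, rfl⟩ := hC.eq_of_rotation_eq_aux hb' hc' hc hr' hr (by simpa using h.symm)
    simp

/-- Locates the codeword hit by the cut between `x` and `y`. Since `b ≠ []`, a cut at a boundary is
charged to the codeword on its right, with `a = []`. -/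
theorem exists_codeword_of_append_mem_kstar {w : List A} (hw : w ∈ C∗) :
    ∀ x y : List A, w = x ++ y → y ≠ [] →
      ∃ t a b r, x = t ++ a ∧ y = b ++ r ∧ t ∈ C∗ ∧ r ∈ C∗ ∧ b ≠ [] ∧ a ++ b ∈ C := by
  refine kstar_induction (P := fun w => ∀ x y : List A, w = x ++ y → y ≠ [] →
      ∃ t a b r, x = t ++ a ∧ y = b ++ r ∧ t ∈ C∗ ∧ r ∈ C∗ ∧ b ≠ [] ∧ a ++ b ∈ C) ?_ ?_ hw
  · intro x y h hy
    exact (hy (List.append_eq_nil_iff.1 h.symm).2).elim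
  · intro c hc r hr ih x y h hy
    rcases List.append_eq_append_iff.1 h with ⟨z, rfl, hz⟩ | ⟨z, rfl, hz⟩
    · obtain ⟨t, a, b, r', rfl, rfl, ht, hr', hb, hab⟩ := ih z y hz hy
      exact ⟨c ++ t, a, b, r', by simp, rfl, append_mem_kstar (mem_kstar_of_mem hc) ht, hr', hb,
        hab⟩
    · by_cases hz0 : z = []
      · subst hz0
        obtain ⟨t, a, b, r', h1, rfl, ht, hr', hb, hab⟩ := ih [] y (by simpa using hz.symm) hy
        obtain ⟨rfl, rfl⟩ := List.append_eq_nil_iff.1 h1.symm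
        refine ⟨x, [], b, r', by simp, rfl, ?_, hr', hb, hab⟩
        simpa using mem_kstar_of_mem hc
      · exact ⟨[], x, z, r, by simp, hz, Language.nil_mem_kstar C, hr, hz0, hc⟩

/-- A rotation is encoded by the codeword `c` that is cut, the offset `i < c.length` of the cut, and
the remaining word of `C∗`. Pairs `(c, i)` contribute `X c'`. Uniqueness is `eq_of_rotation_eq`. -/
theorem languageSeries_rotations_mul_kstar (hC : IsCircularCode C) [Finite A] :
    languageSeries (rotations C) = X * d⁄dX ℚ (languageSeries C) * languageSeries C∗ := by
  have := finite_word_fiber C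
  have := finite_word_fiber C∗
  let e : (Σ c : {w // w ∈ C}, Fin c.1.length) × {w // w ∈ C∗} → {w // w ∈ rotations C} :=
    fun p => ⟨p.1.1.1.drop p.1.2 ++ (p.2.1 ++ p.1.1.1.take p.1.2), by
      constructor
      · have := p.1.2.2
        intro h
        have h := (List.append_eq_nil_iff.1 h).1
        rw [List.drop_eq_nil_iff] at h
        omega
      · refine ⟨p.2.1 ++ p.1.1.1.take p.1.2, p.1.1.1.drop p.1.2, rfl, ?_⟩
        rw [List.append_assoc, List.take_append_drop]
        exact append_mem_kstar p.2.2 (mem_kstar_of_mem p.1.1.2)⟩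
  have he : Function.Bijective e := by
    constructor
    · rintro ⟨⟨⟨c, hc⟩, i, hi⟩, ⟨r, hr⟩⟩ ⟨⟨⟨c', hc'⟩, i', hi'⟩, ⟨r', hr'⟩⟩ h
      have h := congrArg Subtype.val h
      simp only [e] at h hi hi'
      obtain ⟨h1, h2, rfl⟩ := hC.eq_of_rotation_eq (a := c.take i) (a' := c'.take i')
        (by simpa using hi) (by simpa using hi')
        (by simpa using hc) (by simpa using hc') hr hr' h
      obtain rfl : c = c' := by
        rw [← List.take_append_drop i c, h1, h2, List.take_append_drop]
      obtain rfl : i = i' := by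
        have := congrArg List.length h1
        simp only [List.length_take] at this
        omega
      rfl
    · rintro ⟨w, hw0, x, y, rfl, hw⟩
      -- If `y = []` the word is already in `C∗`; its first codeword is cut at offset `0`.
      by_cases hy : y = []
      · subst hy
        have hx : x ≠ [] := by simpa using hw0
        obtain ⟨t, a, b, r, h1, rfl, ht, hr, hb, hab⟩ :=
          exists_codeword_of_append_mem_kstar hw [] x (by simp) hx
        obtain ⟨rfl, rfl⟩ := List.append_eq_nil_iff.1 h1.symm
        refine ⟨⟨⟨⟨b, hab⟩, 0, by simpa [List.length_pos_iff] using hb⟩, ⟨r, hr⟩⟩, ?_⟩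
        simp [e]
      · obtain ⟨t, a, b, r, rfl, rfl, ht, hr, hb, hab⟩ :=
          exists_codeword_of_append_mem_kstar hw x y rfl hy
        refine ⟨⟨⟨⟨a ++ b, hab⟩, a.length, by simpa [List.length_pos_iff] using hb⟩,
          ⟨r ++ t, append_mem_kstar hr ht⟩⟩, ?_⟩
        simp [e]
  have h := sizeSeries_congr (f := fun p => p.1.1.1.length + p.2.1.length)
    (g := fun w : {w // w ∈ rotations C} => w.1.length) e he (by
      rintro ⟨⟨c, i⟩, r⟩
      have := i.2
      simp only [e, List.length_append, List.length_drop, List.length_take]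
      omega)
  rw [languageSeries_eq_sizeSeries (rotations C), ← h,
    sizeSeries_prod (fun c : (Σ c : {w // w ∈ C}, Fin c.1.length) => c.1.1.length)
      (fun c : {w // w ∈ C∗} => c.1.length), sizeSeries_sigma_fin,
    ← languageSeries_eq_sizeSeries, ← languageSeries_eq_sizeSeries]

theorem languageSeries_rotations (hC : IsCircularCode C) [Finite A] :
    languageSeries (rotations C) * (1 - languageSeries C) = X * d⁄dX ℚ (languageSeries C) := by
  rw [hC.languageSeries_rotations_mul_kstar, mul_assoc, hC.languageSeries_kstar, mul_one]

end IsCircularCode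

theorem languageSeries_reverse {A : Type*} (L : Language A) :
    languageSeries L.reverse = languageSeries L := by
  rw [languageSeries_eq_sizeSeries, languageSeries_eq_sizeSeries]
  refine sizeSeries_congr (fun w => ⟨w.1.reverse, w.2⟩) ⟨?_, ?_⟩ (by simp)
  · rintro ⟨u, hu⟩ ⟨w, hw⟩ h
    exact Subtype.ext (List.reverse_injective (congrArg Subtype.val h))
  · rintro ⟨u, hu⟩
    exact ⟨⟨u.reverse, by simpa [Language.mem_reverse] using hu⟩, by simp⟩

theorem rotations_reverse {A : Type*} (C : Language A) :
    rotations C.reverse = (rotations C).reverse := by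
  ext w
  rw [Language.mem_reverse]
  constructor
  · rintro ⟨h0, x, y, rfl, h⟩
    rw [← Language.reverse_kstar, Language.mem_reverse, List.reverse_append] at h
    exact ⟨by simpa [and_comm] using h0, y.reverse, x.reverse, by simp, h⟩
  · rintro ⟨h0, x, y, h1, h⟩
    refine ⟨by rintro rfl; exact h0 rfl, y.reverse, x.reverse, ?_, ?_⟩
    · rw [← List.reverse_append, ← h1, List.reverse_reverse]
    · rw [← Language.reverse_kstar, Language.mem_reverse]
      simpa using h

/-- The mirror image of `IsCircularCode.languageSeries_rotations`. -/
theorem IsCircularCode.languageSeries_rotations_of_reverse {A : Type*} [Finite A]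
    {C : Language A} (hC : IsCircularCode C.reverse) :
    languageSeries (rotations C) * (1 - languageSeries C) = X * d⁄dX ℚ (languageSeries C) := by
  have h := hC.languageSeries_rotations
  rwa [rotations_reverse, languageSeries_reverse, languageSeries_reverse] at h

/-! ### Periodic sequences and their blocks -/

section Window
variable {A B : Type*}

/-- The block of length `n` of a two-sided sequence that starts at `i`. -/
def window (x : ℤ → A) (i : ℤ) (n : ℕ) : List A := List.ofFn fun j : Fin n => x (i + (j : ℕ))

theorem length_window (x : ℤ → A) (i : ℤ) (n : ℕ) : (window x i n).length = n := by
  simp [window]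

theorem getElem_window (x : ℤ → A) (i : ℤ) (n k : ℕ) (h : k < (window x i n).length) :
    (window x i n)[k] = x (i + k) := by
  simp [window]

theorem window_add (x : ℤ → A) (i : ℤ) (a b : ℕ) :
    window x i (a + b) = window x i a ++ window x (i + a) b := by
  simp [window, List.ofFn_add, add_assoc]

theorem map_window (f : A → B) (x : ℤ → A) (i : ℤ) (n : ℕ) :
    (window x i n).map f = window (f ∘ x) i n := by
  simp [window, List.map_ofFn, Function.comp_def]

theorem iterate_shiftMap (x : ℤ → A) (n : ℕ) (i : ℤ) : (shiftMap^[n] x) i = x (i + n) := by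
  induction n generalizing x with
  | zero => simp
  | succ n ih =>
    rw [Function.iterate_succ_apply, ih]
    simp only [shiftMap]
    congr 1
    push_cast
    ring

theorem mem_ptsOfPeriod_shiftMap {x : ℤ → A} {n : ℕ} :
    x ∈ Function.ptsOfPeriod shiftMap n ↔ Function.Periodic x (n : ℤ) := by
  rw [Function.mem_ptsOfPeriod]
  constructor
  · intro h i
    rw [← iterate_shiftMap x, h]
  · intro h
    funext i
    rw [iterate_shiftMap, h i]

theorem window_mul {x : ℤ → A} {n : ℕ} (hx : Function.Periodic x (n : ℤ)) (m : ℕ) :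
    window x 0 (n * m) = (List.replicate m (window x 0 n)).flatten := by
  induction m with
  | zero => simp [window]
  | succ m ih =>
    rw [Nat.mul_succ, Nat.add_comm, window_add, List.replicate_succ, List.flatten_cons, ← ih]
    congr 1
    simp only [window]
    congr 1
    funext j
    rw [← hx (0 + (j : ℕ))]
    congr 1
    ring

theorem periodic_map_emod {x : ℤ → A} {n : ℕ} (hx : Function.Periodic x (n : ℤ)) (i : ℤ) :
    x (i % n) = x i := by
  have h := hx.int_mul (i / n) (i % n)
  rw [← h]
  congr 1
  rw [mul_comm]
  simpa using (Int.emod_add_mul_ediv i n)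

theorem periodic_ext {x y : ℤ → A} {n : ℕ} (hn : n ≠ 0) (hx : Function.Periodic x (n : ℤ))
    (hy : Function.Periodic y (n : ℤ)) (h : window x 0 n = window y 0 n) : x = y := by
  funext i
  rw [← periodic_map_emod hx i, ← periodic_map_emod hy i]
  have h0 := Int.emod_nonneg i (b := n) (by exact_mod_cast hn)
  have h1 := Int.emod_lt_of_pos i (b := n) (by omega)
  obtain ⟨k, hk⟩ := Int.eq_ofNat_of_zero_le h0
  rw [hk] at h1 ⊢
  have hk' : k < n := by exact_mod_cast h1
  have h2 := List.getElem_of_eq h (i := k) (by rw [length_window]; exact hk')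
  rw [getElem_window, getElem_window] at h2
  simpa using h2

theorem exists_periodic_window (w : List A) (hw : w ≠ []) :
    ∃ x : ℤ → A, Function.Periodic x (w.length : ℤ) ∧ window x 0 w.length = w := by
  have hn : 0 < w.length := List.length_pos_iff.2 hw
  have hlt : ∀ i : ℤ, (i % w.length).toNat < w.length := fun i => by
    have h0 := Int.emod_nonneg i (b := w.length) (by omega)
    have h1 := Int.emod_lt_of_pos i (b := w.length) (by omega)
    omega
  refine ⟨fun i => w[(i % w.length).toNat]'(hlt i), fun i => ?_, ?_⟩
  · simp
  · apply List.ext_getElem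
    · rw [length_window]
    · intro k h1 h2
      rw [getElem_window]
      congr 1
      rw [zero_add, Int.emod_eq_of_lt (by omega) (by omega)]
      simp

/-- The words of length `n` all of whose powers are in `L`. -/
def periodicWords (L : Language A) (n : ℕ) : Set (List A) :=
  {w | w.length = n ∧ ∀ m, (List.replicate m w).flatten ∈ L}

theorem periodicCount_eq_ncard_periodicWords {Y : Set (ℤ → A)} {L : Language A} {n : ℕ}
    (hn : n ≠ 0) (h : ∀ x : ℤ → A, Function.Periodic x (n : ℤ) →
      (x ∈ Y ↔ ∀ m, (List.replicate m (window x 0 n)).flatten ∈ L)) :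
    periodicCount Y n = (periodicWords L n).ncard := by
  have himg : (fun x => window x 0 n) '' (Y ∩ Function.ptsOfPeriod shiftMap n) =
      periodicWords L n := by
    ext w
    constructor
    · rintro ⟨x, ⟨hxY, hx⟩, rfl⟩
      exact ⟨length_window x 0 n, (h x (mem_ptsOfPeriod_shiftMap.1 hx)).1 hxY⟩
    · rintro ⟨rfl, hw⟩
      obtain ⟨x, hx, hxw⟩ := exists_periodic_window w (by rintro rfl; exact hn rfl)
      refine ⟨x, ⟨(h x hx).2 ?_, mem_ptsOfPeriod_shiftMap.2 hx⟩, hxw⟩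
      rwa [hxw]
  rw [periodicCount, ← himg, Set.InjOn.ncard_image]
  rintro x ⟨_, hx⟩ y ⟨_, hy⟩ hxy
  exact periodic_ext hn (mem_ptsOfPeriod_shiftMap.1 hx) (mem_ptsOfPeriod_shiftMap.1 hy) hxy

/-- After reduction of `i` modulo `n`, every block is a factor of a power of the first period. -/
theorem forall_window_mem_iff {L : Language A} (hL : ∀ u w t : List A, u ++ w ++ t ∈ L → w ∈ L)
    {n : ℕ} (hn : n ≠ 0) {x : ℤ → A} (hx : Function.Periodic x (n : ℤ)) :
    (∀ i k, window x i k ∈ L) ↔ ∀ m, (List.replicate m (window x 0 n)).flatten ∈ L := by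
  constructor
  · intro h m
    rw [← window_mul hx]
    exact h 0 _
  · intro h i k
    have h0 := Int.emod_nonneg i (b := n) (by exact_mod_cast hn)
    obtain ⟨a, ha⟩ := Int.eq_ofNat_of_zero_le h0
    have hi : window x i k = window x (0 + a) k := by
      simp only [window]
      congr 1
      funext j
      rw [← periodic_map_emod hx (i + _), ← periodic_map_emod hx (0 + a + _), zero_add]
      congr 1
      have : (a : ℤ) = i % n := ha.symm
      rw [this]
      simp
    -- `a + k` copies of the period are certainly long enough to contain the block of length `k` at
    -- `a`.
    have hle : a + k ≤ n * (a + k) := Nat.le_mul_of_pos_left _ (Nat.pos_of_ne_zero hn)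
    have hm := h (a + k)
    rw [← window_mul hx, show n * (a + k) = a + k + (n * (a + k) - (a + k)) by omega, window_add,
      window_add, ← hi] at hm
    exact hL _ _ _ hm

end Window

/-! ### Periodic points of sofic shifts -/

namespace LabeledGraph
variable {V E S : Type*} (G : LabeledGraph V E S)

theorem isPath_append {u w : V} {p q : List E} :
    G.IsPath u (p ++ q) w ↔ ∃ x, G.IsPath u p x ∧ G.IsPath x q w := by
  induction p generalizing u with
  | nil => simp [IsPath]
  | cons e p ih => simp [IsPath, ih, and_assoc]

/-- The label sequences of paths. -/
def pathLabels : Language S := {l | ∃ u w p, G.IsPath u p w ∧ p.map G.label = l}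

theorem isPath_window {p : ℤ → E} (hp : ∀ i, G.target (p i) = G.source (p (i + 1))) (i : ℤ)
    (n : ℕ) : G.IsPath (G.source (p i)) (window p i n) (G.source (p (i + n))) := by
  induction n with
  | zero => simp [window, IsPath]
  | succ n ih =>
    rw [window_add, isPath_append]
    refine ⟨_, ih, ?_⟩
    simp [window, IsPath, hp, add_assoc]

theorem adjacent_of_isPath_window {p : ℤ → E} {n : ℕ} {u w : V}
    (h : G.IsPath u (window p 0 n) w) {k : ℕ} (hk : k + 1 < n) :
    G.target (p k) = G.source (p (k + 1)) := by
  rw [show n = k + (1 + (1 + (n - (k + 2)))) by omega, window_add, isPath_append] at h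
  obtain ⟨x, -, h⟩ := h
  rw [window_add, isPath_append] at h
  obtain ⟨y, h1, h⟩ := h
  rw [window_add, isPath_append] at h
  obtain ⟨z, h2, -⟩ := h
  simp only [window, IsPath, List.ofFn_succ, List.ofFn_zero, Fin.val_zero, zero_add, add_zero,
    Nat.cast_zero, Nat.cast_one] at h1 h2
  rw [h1.2, h2.1]

theorem exists_vertices_of_replicate {l : List S} (m : ℕ) {u : V} {p : List E} {w : V}
    (hp : G.IsPath u p w) (hl : p.map G.label = (List.replicate m l).flatten) :
    ∃ q : ℕ → V, q 0 = u ∧ ∀ i, i < m →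
      ∃ p', G.IsPath (q i) p' (q (i + 1)) ∧ p'.map G.label = l := by
  induction m generalizing u p with
  | zero => exact ⟨fun _ => u, rfl, fun i hi => (Nat.not_lt_zero i hi).elim⟩
  | succ m ih =>
    rw [List.replicate_succ, List.flatten_cons, List.map_eq_append_iff] at hl
    obtain ⟨p1, p2, rfl, h1, h2⟩ := hl
    obtain ⟨x, hx1, hx2⟩ := (G.isPath_append).1 hp
    obtain ⟨q, hq0, hq⟩ := ih hx2 h2
    refine ⟨fun i => Nat.casesOn i u q, rfl, fun i hi => ?_⟩
    cases i with
    | zero => exact ⟨p1, by simpa [hq0] using hx1, h1⟩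
    | succ i => exact hq i (by omega)

/-- A path reading `Nat.card V` copies of `l` has `Nat.card V + 1` vertices at the ends of the
copies, so two of them coincide. The path between them closes up, possibly only after several
copies. -/
theorem exists_closed_path_of_replicate [Finite V] {l : List S}
    (h : ∀ m, (List.replicate m l).flatten ∈ G.pathLabels) :
    ∃ (u : V) (p : List E) (m : ℕ), m ≠ 0 ∧ G.IsPath u p u ∧
      p.map G.label = (List.replicate m l).flatten := by
  obtain ⟨u, w, p, hp, hl⟩ := h (Nat.card V)
  obtain ⟨q, -, hq⟩ := G.exists_vertices_of_replicate _ hp hl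
  have chain : ∀ i j, i ≤ j → j ≤ Nat.card V → ∃ p', G.IsPath (q i) p' (q j) ∧
      p'.map G.label = (List.replicate (j - i) l).flatten := by
    intro i j hij
    induction j, hij using Nat.le_induction with
    | base => exact fun _ => ⟨[], rfl, by simp⟩
    | succ j hij ih =>
      intro hj
      obtain ⟨p1, h1, h2⟩ := ih (by omega)
      obtain ⟨p2, h3, h4⟩ := hq j (by omega)
      refine ⟨p1 ++ p2, (G.isPath_append).2 ⟨_, h1, h3⟩, ?_⟩
      rw [show j + 1 - i = (j - i) + 1 by omega, List.replicate_add, List.flatten_append,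
        List.map_append, h2, h4]
      simp
  obtain ⟨i, j, hij, hqij⟩ : ∃ i j : Fin (Nat.card V + 1), i < j ∧ q i = q j := by
    have hinj : ¬ Function.Injective fun i : Fin (Nat.card V + 1) => q i := by
      intro hinj
      have := Nat.card_le_card_of_injective _ hinj
      simp at this
    simp only [Function.Injective, not_forall] at hinj
    obtain ⟨i, j, h1, h2⟩ := hinj
    rcases lt_or_gt_of_ne h2 with h3 | h3
    · exact ⟨i, j, h3, h1⟩
    · exact ⟨j, i, h3, h1.symm⟩
  obtain ⟨p', h1, h2⟩ := chain i j hij.le (by omega)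
  rw [← hqij] at h1
  exact ⟨_, p', _, by have : (i : ℕ) < j := hij; omega, h1, h2⟩

theorem mem_soficShift_iff_of_periodic [Finite V] {n : ℕ} (hn : n ≠ 0) {x : ℤ → S}
    (hx : Function.Periodic x (n : ℤ)) :
    x ∈ G.soficShift ↔ ∀ m, (List.replicate m (window x 0 n)).flatten ∈ G.pathLabels := by
  constructor
  · rintro ⟨p, hp, hpx⟩ m
    rw [← window_mul hx]
    refine ⟨_, _, _, G.isPath_window hp 0 (n * m), ?_⟩
    rw [map_window]
    congr 1
    funext i
    exact (hpx i).symm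
  · intro h
    obtain ⟨u, l, m, hm, hl, hlab⟩ := G.exists_closed_path_of_replicate h
    rw [← window_mul hx] at hlab
    have hlen : l.length = n * m := by
      rw [← List.length_map (f := G.label), hlab, length_window]
    have hnm : n * m ≠ 0 := Nat.mul_ne_zero hn hm
    obtain ⟨p, hp, hpl⟩ := exists_periodic_window l (by rintro rfl; simp at hlen; omega)
    rw [hlen] at hp hpl
    have hx' : Function.Periodic x ((n * m : ℕ) : ℤ) := by
      have := hx.int_mul m
      push_cast
      rwa [mul_comm]
    have hper : Function.Periodic (G.label ∘ p) ((n * m : ℕ) : ℤ) := hp.comp _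
    have hxp : G.label ∘ p = x := by
      refine periodic_ext hnm hper hx' ?_
      rw [← map_window, hpl, hlab]
    -- Two rounds of the closed path, so that the adjacency at the seam is also read off inside a
    -- finite path.
    have h2 : G.IsPath u (window p 0 (n * m * 2)) u := by
      rw [window_mul hp, hpl]
      simpa using (G.isPath_append).2 ⟨u, hl, hl⟩
    refine ⟨p, fun i => ?_, fun i => by rw [← hxp]; rfl⟩
    have h0 := Int.emod_nonneg i (b := ((n * m : ℕ) : ℤ)) (by exact_mod_cast hnm)
    have h1 := Int.emod_lt_of_pos i (b := ((n * m : ℕ) : ℤ)) (by omega)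
    obtain ⟨k, hk⟩ := Int.eq_ofNat_of_zero_le h0
    have h3 := G.adjacent_of_isPath_window h2 (k := k) (by omega)
    rw [← periodic_map_emod hp i, hk]
    have h4 : p (i + 1) = p (k + 1) := by
      rw [← periodic_map_emod hp (i + 1), ← periodic_map_emod hp (k + 1)]
      rw [← Int.emod_add_emod, hk]
    rw [h4]
    exact h3

theorem periodicCount_soficShift [Finite V] {n : ℕ} (hn : n ≠ 0) :
    periodicCount G.soficShift n = (periodicWords G.pathLabels n).ncard :=
  periodicCount_eq_ncard_periodicWords hn fun _ hx => G.mem_soficShift_iff_of_periodic hn hx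

end LabeledGraph

/-! ### The zero of the Dyck monoid -/

namespace DyckMonoid
variable {Γ : Type*}

theorem neg_mul_pos (γ : Γ) : of (DyckGen.neg γ) * of (DyckGen.pos γ) = 1 := by
  rw [of, of, ← map_mul, ← map_one (mk (Γ := Γ)), ← WithZero.coe_mul]
  exact (Con.eq _).2 (ConGen.Rel.of _ _ (DyckRel.cancel γ))

theorem neg_mul_pos_of_ne {γ γ' : Γ} (h : γ ≠ γ') :
    of (DyckGen.neg γ) * of (DyckGen.pos γ') = zero Γ := by
  rw [of, of, ← map_mul, ← WithZero.coe_mul]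
  exact (Con.eq _).2 (ConGen.Rel.of _ _ (DyckRel.clash γ γ' h))

theorem zero_mul (x : DyckMonoid Γ) : zero Γ * x = zero Γ := by
  obtain ⟨y, rfl⟩ := Con.mk'_surjective x
  change mk 0 * mk y = mk 0
  rw [← map_mul, MulZeroClass.zero_mul]

theorem mul_zero (x : DyckMonoid Γ) : x * zero Γ = zero Γ := by
  obtain ⟨y, rfl⟩ := Con.mk'_surjective x
  change mk y * mk 0 = mk 0
  rw [← map_mul, MulZeroClass.mul_zero]

open Classical in
/-- The action of the generators on functions on stacks. -/
noncomputable def stackAction : DyckGen Γ → Module.End ℚ (List Γ → ℚ)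
  | DyckGen.neg γ =>
    { toFun := fun f s => f (γ :: s)
      map_add' := fun _ _ => rfl
      map_smul' := fun _ _ => rfl }
  | DyckGen.pos γ =>
    { toFun := fun f s => if s.head? = some γ then f s.tail else 0
      map_add' := fun f g => by
        funext s
        by_cases h : s.head? = some γ <;> simp [h]
      map_smul' := fun c f => by
        funext s
        by_cases h : s.head? = some γ <;> simp [h] }

/-- Evaluated at `s`, the product first pushes `γ` on `s` and then tries to pop `γ'`. Acting on
functions instead of stacks gives this order and makes failure the zero operator. -/
theorem stackAction_neg_mul_pos (γ γ' : Γ) [Decidable (γ = γ')] :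
    stackAction (DyckGen.neg γ) * stackAction (DyckGen.pos γ') = if γ = γ' then 1 else 0 := by
  ext f s
  by_cases h : γ = γ' <;> simp [stackAction, h]

/-- The representation of the Dyck monoid on functions on stacks. -/
noncomputable def stackRep : DyckMonoid Γ →* Module.End ℚ (List Γ → ℚ) :=
  Con.lift (conGen (DyckRel Γ))
    (WithZero.lift' (FreeMonoid.lift stackAction) :
      WithZero (FreeMonoid (DyckGen Γ)) →*₀ Module.End ℚ (List Γ → ℚ)).toMonoidHom <| by
    classical
    refine Con.conGen_le.2 fun x y h => ?_
    rw [Con.ker_rel]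
    cases h with
    | cancel γ => simpa using stackAction_neg_mul_pos γ γ
    | clash γ γ' h => simpa [h] using stackAction_neg_mul_pos γ γ'

/-- The presentation does not collapse because in `stackRep` the unit acts as the identity and
`zero` as `0` on a nonzero space. -/
theorem one_ne_zero : (1 : DyckMonoid Γ) ≠ zero Γ := by
  intro h
  have h1 : stackRep (zero Γ) = 0 := by
    change stackRep (mk 0) = 0
    change (WithZero.lift' (FreeMonoid.lift stackAction) :
      WithZero (FreeMonoid (DyckGen Γ)) →*₀ Module.End ℚ (List Γ → ℚ)) 0 = 0
    exact map_zero _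
  rw [← h, map_one] at h1
  exact _root_.one_ne_zero h1

theorem ne_zero_of_mul_eq_one {x y : DyckMonoid Γ} (h : x * y = 1) :
    x ≠ zero Γ ∧ y ≠ zero Γ := by
  constructor
  · rintro rfl
    exact one_ne_zero (by rw [← h, zero_mul])
  · rintro rfl
    exact one_ne_zero (by rw [← h, mul_zero])

end DyckMonoid

/-! ### Values and heights of words -/

section Admissible
variable {S Γ : Type*} {Kneg Kpos : Γ → ℕ}

/-- The value of a word in the Dyck monoid. -/
def wordValue (w : List (S ⊕ DyckLoop Kneg Kpos)) : DyckMonoid Γ := (w.map motzkinValue).prod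

@[simp]
theorem wordValue_nil : wordValue ([] : List (S ⊕ DyckLoop Kneg Kpos)) = 1 := by
  simp [wordValue]

@[simp]
theorem wordValue_append (u w : List (S ⊕ DyckLoop Kneg Kpos)) :
    wordValue (u ++ w) = wordValue u * wordValue w := by
  simp [wordValue]

@[simp]
theorem wordValue_neg_cons (γ : Γ) (k : Fin (Kneg γ)) (w : List (S ⊕ DyckLoop Kneg Kpos)) :
    wordValue (Sum.inr (DyckLoop.neg γ k) :: w) =
      DyckMonoid.of (DyckGen.neg γ) * wordValue w := by
  simp [wordValue, motzkinValue]

@[simp]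
theorem wordValue_pos_cons (γ : Γ) (k : Fin (Kpos γ)) (w : List (S ⊕ DyckLoop Kneg Kpos)) :
    wordValue (Sum.inr (DyckLoop.pos γ k) :: w) =
      DyckMonoid.of (DyckGen.pos γ) * wordValue w := by
  simp [wordValue, motzkinValue]

@[simp]
theorem wordValue_map_inl (r : List S) :
    wordValue (r.map Sum.inl : List (S ⊕ DyckLoop Kneg Kpos)) = 1 := by
  induction r with
  | nil => simp
  | cons s r ih =>
    have : wordValue (Kneg := Kneg) (Kpos := Kpos) (Sum.inl s :: r.map Sum.inl) =
        1 * wordValue (r.map Sum.inl : List (S ⊕ DyckLoop Kneg Kpos)) := by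
      simp [wordValue, motzkinValue]
    rw [List.map_cons, this, ih, one_mul]

theorem motzkinAdmissible_iff {w : List (S ⊕ DyckLoop Kneg Kpos)} :
    MotzkinAdmissible w ↔ wordValue w ≠ DyckMonoid.zero Γ := Iff.rfl

theorem motzkinAdmissible_of_append {u w t : List (S ⊕ DyckLoop Kneg Kpos)}
    (h : MotzkinAdmissible (u ++ w ++ t)) : MotzkinAdmissible w := by
  rw [motzkinAdmissible_iff] at h ⊢
  intro h0
  rw [wordValue_append, wordValue_append, h0, DyckMonoid.mul_zero, DyckMonoid.zero_mul] at h
  exact h rfl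

/-- The change of the number of open brackets along a word. -/
def height (w : List (S ⊕ DyckLoop Kneg Kpos)) : ℤ :=
  (w.map fun
    | Sum.inl _ => 0
    | Sum.inr (DyckLoop.neg _ _) => 1
    | Sum.inr (DyckLoop.pos _ _) => -1).sum

@[simp]
theorem height_nil : height ([] : List (S ⊕ DyckLoop Kneg Kpos)) = 0 := by
  simp [height]

@[simp]
theorem height_append (u w : List (S ⊕ DyckLoop Kneg Kpos)) :
    height (u ++ w) = height u + height w := by
  simp [height]

@[simp]
theorem height_neg_cons (γ : Γ) (k : Fin (Kneg γ)) (w : List (S ⊕ DyckLoop Kneg Kpos)) :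
    height (Sum.inr (DyckLoop.neg γ k) :: w) = 1 + height w := by
  simp [height]

@[simp]
theorem height_pos_cons (γ : Γ) (k : Fin (Kpos γ)) (w : List (S ⊕ DyckLoop Kneg Kpos)) :
    height (Sum.inr (DyckLoop.pos γ k) :: w) = -1 + height w := by
  simp [height]

@[simp]
theorem height_map_inl (r : List S) :
    height (r.map Sum.inl : List (S ⊕ DyckLoop Kneg Kpos)) = 0 := by
  induction r with
  | nil => simp
  | cons s r ih => simpa [height] using ih

/-- A language is factorial if it contains the factors of its words. -/
def IsFactorial {A : Type*} (L : Language A) : Prop :=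
  ∀ u w t : List A, u ++ w ++ t ∈ L → w ∈ L

/-- With `w = x ++ y`, the `m`-th power of `y ++ x` is a factor of the power `m + 1` of `w`: put `x`
in front and `y` behind. -/
theorem IsFactorial.replicate_rotated {A : Type*} {L : Language A} (hL : IsFactorial L)
    {w w' : List A} (hw : w ~r w') (h : ∀ m, (List.replicate m w).flatten ∈ L) (m : ℕ) :
    (List.replicate m w').flatten ∈ L := by
  obtain ⟨n, hn, rfl⟩ := List.isRotated_iff_mod.1 hw
  rw [List.rotate_eq_drop_append_take hn]
  set x := w.take n
  set y := w.drop n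
  have hxy : w = x ++ y := (List.take_append_drop n w).symm
  have key : ∀ m, x ++ (List.replicate m (y ++ x)).flatten =
      (List.replicate m (x ++ y)).flatten ++ x := by
    intro m
    induction m with
    | zero => simp
    | succ m ih =>
      rw [List.replicate_succ, List.flatten_cons, List.replicate_succ, List.flatten_cons,
        List.append_assoc (x ++ y), ← ih]
      simp
  refine hL x _ y ?_
  have := h (m + 1)
  rw [hxy, List.replicate_succ', List.flatten_append] at this
  rw [key]
  simpa using this

theorem mem_rotations_of_isRotated {A : Type*} {C : Language A} {w w' : List A} (h0 : w ≠ [])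
    (h : w ~r w') (hw' : w' ∈ C∗) : w ∈ rotations C := by
  obtain ⟨n, hn, rfl⟩ := List.isRotated_iff_mod.1 h
  rw [List.rotate_eq_drop_append_take hn] at hw'
  exact ⟨h0, _, _, (List.take_append_drop n w).symm, hw'⟩

theorem isRotated_of_mem_rotations {A : Type*} {C : Language A} {w : List A}
    (h : w ∈ rotations C) : ∃ w', w ~r w' ∧ w' ∈ C∗ ∧ w' ≠ [] := by
  obtain ⟨h0, x, y, rfl, h⟩ := h
  exact ⟨_, List.isRotated_append, h, by simpa [and_comm] using h0⟩

theorem height_eq_of_isRotated {w w' : List (S ⊕ DyckLoop Kneg Kpos)} (h : w ~r w') :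
    height w = height w' := (h.perm.map _).sum_eq

end Admissible

/-! ### The three codes and their circularity -/

section Codes
variable {S Γ : Type*} {Kneg Kpos : Γ → ℕ}

/-- The words with value `1` in the Dyck monoid whose symbols in `S` form words of `R`. -/
inductive Neutral (Kneg Kpos : Γ → ℕ) (R : Language S) : List (S ⊕ DyckLoop Kneg Kpos) → Prop
  | base (r : List S) (hr : r ∈ R) : Neutral Kneg Kpos R (r.map Sum.inl)
  | step (u m : List (S ⊕ DyckLoop Kneg Kpos)) (γ : Γ) (k : Fin (Kneg γ)) (k' : Fin (Kpos γ))
      (r : List S) (hu : Neutral Kneg Kpos R u) (hm : Neutral Kneg Kpos R m) (hr : r ∈ R) :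
      Neutral Kneg Kpos R (u ++ Sum.inr (DyckLoop.neg γ k) :: (m ++
        Sum.inr (DyckLoop.pos γ k') :: r.map Sum.inl))

/-- The language of neutral words. -/
def neutralLanguage (Kneg Kpos : Γ → ℕ) (R : Language S) : Language (S ⊕ DyckLoop Kneg Kpos) :=
  {w | Neutral Kneg Kpos R w}

/-- A symbol `γ(-)` that is never cancelled, followed by a neutral word. -/
def negCode (Kneg Kpos : Γ → ℕ) (R : Language S) : Language (S ⊕ DyckLoop Kneg Kpos) :=
  {w | ∃ (γ : Γ) (k : Fin (Kneg γ)) (m : List (S ⊕ DyckLoop Kneg Kpos)),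
    Neutral Kneg Kpos R m ∧ w = Sum.inr (DyckLoop.neg γ k) :: m}

/-- A neutral word, followed by a symbol `γ(+)` that is never cancelled. -/
def posCode (Kneg Kpos : Γ → ℕ) (R : Language S) : Language (S ⊕ DyckLoop Kneg Kpos) :=
  {w | ∃ (γ : Γ) (k : Fin (Kpos γ)) (m : List (S ⊕ DyckLoop Kneg Kpos)),
    Neutral Kneg Kpos R m ∧ w = m ++ [Sum.inr (DyckLoop.pos γ k)]}

/-- A bracketed neutral word, followed by a word of `R`. -/
def balancedCode (Kneg Kpos : Γ → ℕ) (R : Language S) : Language (S ⊕ DyckLoop Kneg Kpos) :=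
  {w | ∃ (γ : Γ) (k : Fin (Kneg γ)) (k' : Fin (Kpos γ)) (m : List (S ⊕ DyckLoop Kneg Kpos))
    (r : List S), Neutral Kneg Kpos R m ∧ r ∈ R ∧ w = Sum.inr (DyckLoop.neg γ k) :: (m ++
      Sum.inr (DyckLoop.pos γ k') :: r.map Sum.inl)}

variable {R : Language S}

namespace Neutral

theorem wordValue_eq_one {w : List (S ⊕ DyckLoop Kneg Kpos)} (h : Neutral Kneg Kpos R w) :
    wordValue w = 1 := by
  induction h with
  | base r hr => simp
  | step u m γ k k' r hu hm hr ihu ihm =>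
    simp [ihu, ihm, DyckMonoid.neg_mul_pos]

theorem height_eq_zero {w : List (S ⊕ DyckLoop Kneg Kpos)} (h : Neutral Kneg Kpos R w) :
    height w = 0 := by
  induction h with
  | base r hr => simp
  | step u m γ k k' r hu hm hr ihu ihm => simp [ihu, ihm]

theorem height_prefix_nonneg {w : List (S ⊕ DyckLoop Kneg Kpos)} (h : Neutral Kneg Kpos R w) :
    ∀ a b, w = a ++ b → 0 ≤ height a := by
  induction h with
  | base r hr =>
    intro a b h
    obtain ⟨a', b', -, rfl, -⟩ := List.map_eq_append_iff.1 h
    simp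
  | step u m γ k k' r hu hm hr ihu ihm =>
    intro a b h
    rcases List.append_eq_append_iff.1 h with ⟨z, rfl, hz⟩ | ⟨z, hz, -⟩
    · rw [height_append, hu.height_eq_zero]
      cases z with
      | nil => simp
      | cons x z =>
        rw [List.cons_append, List.cons.injEq] at hz
        obtain ⟨rfl, hz⟩ := hz
        rcases List.append_eq_append_iff.1 hz with ⟨y, rfl, hy⟩ | ⟨y, hy, -⟩
        · rw [height_neg_cons, height_append, hm.height_eq_zero]
          cases y with
          | nil => simp
          | cons x y =>
            rw [List.cons_append, List.cons.injEq] at hy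
            obtain ⟨rfl, hy⟩ := hy
            obtain ⟨a', b', -, rfl, -⟩ := List.map_eq_append_iff.1 hy
            simp
        · have := ihm _ _ hy
          rw [height_neg_cons]
          omega
    · exact ihu _ _ hz

theorem append (hR : ∀ r ∈ R, ∀ r' ∈ R, r ++ r' ∈ R) {u w : List (S ⊕ DyckLoop Kneg Kpos)}
    (hu : Neutral Kneg Kpos R u) (hw : Neutral Kneg Kpos R w) : Neutral Kneg Kpos R (u ++ w) := by
  induction hw with
  | base r hr =>
    cases hu with
    | base r' hr' =>
      rw [← List.map_append]
      exact base _ (hR _ hr' _ hr)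
    | step u m γ k k' r' hu hm hr' =>
      have := step u m γ k k' (r' ++ r) hu hm (hR _ hr' _ hr)
      simpa using this
  | step u' m γ k k' r hu' hm hr ihu ihm =>
    have := step (u ++ u') m γ k k' r ihu hm hr
    simpa using this

theorem exists_eq_append_balanced {w : List (S ⊕ DyckLoop Kneg Kpos)}
    (h : Neutral Kneg Kpos R w) :
    ∃ r ∈ R, ∃ c ∈ (balancedCode Kneg Kpos R)∗, w = r.map Sum.inl ++ c := by
  induction h with
  | base r hr => exact ⟨r, hr, [], Language.nil_mem_kstar _, by simp⟩
  | step u m γ k k' r hu hm hr ihu ihm =>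
    obtain ⟨r', hr', c, hc, rfl⟩ := ihu
    exact ⟨r', hr', _, append_mem_kstar hc (mem_kstar_of_mem ⟨γ, k, k', m, r, hm, hr, rfl⟩),
      by simp⟩

theorem append_kstar_balanced {w : List (S ⊕ DyckLoop Kneg Kpos)}
    (hw : Neutral Kneg Kpos R w) {c : List (S ⊕ DyckLoop Kneg Kpos)}
    (hc : c ∈ (balancedCode Kneg Kpos R)∗) : Neutral Kneg Kpos R (w ++ c) := by
  refine kstar_induction_right (P := fun c => Neutral Kneg Kpos R (w ++ c)) (by simpa using hw)
    ?_ hc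
  rintro _ ⟨γ, k, k', m, r, hm, hr, rfl⟩ t - ht
  rw [← List.append_assoc]
  exact step _ m γ k k' r ht hm hr

theorem of_mem_kstar_balanced (h0 : [] ∈ R) {c : List (S ⊕ DyckLoop Kneg Kpos)}
    (hc : c ∈ (balancedCode Kneg Kpos R)∗) : Neutral Kneg Kpos R c := by
  simpa using (base [] h0).append_kstar_balanced hc

end Neutral

/-- The first symbol of each codeword raises the height by `1`, and the neutral word behind it never
falls below its starting level. -/
theorem height_kstar_negCode {w : List (S ⊕ DyckLoop Kneg Kpos)}
    (hw : w ∈ (negCode Kneg Kpos R)∗) :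
    ∀ a b, w = a ++ b → 0 ≤ height a ∧ (a ≠ [] → 1 ≤ height a) := by
  refine kstar_induction (P := fun w => ∀ a b, w = a ++ b → 0 ≤ height a ∧
    (a ≠ [] → 1 ≤ height a)) ?_ ?_ hw
  · intro a b h
    obtain ⟨rfl, -⟩ := List.append_eq_nil_iff.1 h.symm
    simp
  · rintro _ ⟨γ, k, m, hm, rfl⟩ t - ih a b h
    cases a with
    | nil => simp
    | cons x a =>
      simp only [List.cons_append, List.cons.injEq] at h
      obtain ⟨rfl, h⟩ := h
      have : 0 ≤ height a := by
        rcases List.append_eq_append_iff.1 h with ⟨z, rfl, hz⟩ | ⟨z, hz, -⟩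
        · rw [height_append, hm.height_eq_zero]
          simpa using (ih _ _ hz).1
        · exact hm.height_prefix_nonneg _ _ hz
      rw [height_neg_cons]
      omega

theorem height_kstar_posCode {w : List (S ⊕ DyckLoop Kneg Kpos)}
    (hw : w ∈ (posCode Kneg Kpos R)∗) :
    ∀ a b, w = a ++ b → height b ≤ 0 ∧ (b ≠ [] → height b ≤ -1) := by
  refine kstar_induction_right (P := fun w => ∀ a b, w = a ++ b → height b ≤ 0 ∧
    (b ≠ [] → height b ≤ -1)) ?_ ?_ hw
  · intro a b h
    obtain ⟨-, rfl⟩ := List.append_eq_nil_iff.1 h.symm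
    simp
  · rintro _ ⟨γ, k, m, hm, rfl⟩ t - ih a b h
    rcases b.eq_nil_or_concat with rfl | ⟨b, x, rfl⟩
    · simp
    · simp only [List.concat_eq_append, ← List.append_assoc] at h
      obtain ⟨h2, h'⟩ := List.append_inj' h rfl
      simp only [List.cons.injEq, and_true] at h'
      subst h'
      have : height b ≤ 0 := by
        rcases List.append_eq_append_iff.1 h2 with ⟨z, hz, hz'⟩ | ⟨z, hz, rfl⟩
        · have h1 := hm.height_prefix_nonneg _ _ hz'
          have h2 := hm.height_eq_zero
          rw [hz', height_append] at h2
          omega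
        · rw [height_append, hm.height_eq_zero]
          simpa using (ih _ _ hz).1
      simp only [List.concat_eq_append, height_append, height_pos_cons, height_nil]
      omega

/-- A proper suffix of a codeword is a suffix of a neutral word, so its height is at most `0`; a
nonempty prefix of a concatenation of codewords has height at least `1`. -/
theorem isCircularCode_negCode : IsCircularCode (negCode Kneg Kpos R) where
  nil_notMem := by rintro ⟨γ, k, m, -, h⟩; simp at h
  suffix := by
    rintro a b r ha hb ⟨γ, k, m, hm, h⟩ hr
    cases a with
    | nil => exact ha rfl
    | cons x a =>
      rw [List.cons_append, List.cons.injEq] at h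
      obtain ⟨-, rfl⟩ := h
      have h1 := hm.height_prefix_nonneg _ _ rfl
      have h2 := hm.height_eq_zero
      have h3 := (height_kstar_negCode hr _ _ rfl).2 hb
      rw [height_append] at h2
      omega

/-- The mirror image is needed: dropping a neutral prefix of a codeword can leave another codeword,
so `posCode` itself may violate the suffix condition. -/
theorem isCircularCode_reverse_posCode : IsCircularCode (posCode Kneg Kpos R).reverse where
  nil_notMem := by rintro ⟨γ, k, m, -, h⟩; simp at h
  suffix := by
    rintro a b r ha hb ⟨γ, k, m, hm, h⟩ hr
    rw [← Language.reverse_kstar, Language.mem_reverse, List.reverse_append] at hr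
    cases a with
    | nil => exact ha rfl
    | cons x a =>
      simp only [List.cons_append, List.reverse_cons, List.reverse_append] at h
      obtain ⟨rfl, -⟩ := List.append_inj' h rfl
      have h1 := hm.height_prefix_nonneg _ _ rfl
      have h2 := (height_kstar_posCode hr _ _ rfl).2 (by simpa using hb)
      omega

theorem head_of_mem_kstar_balanced {w : List (S ⊕ DyckLoop Kneg Kpos)}
    (hw : w ∈ (balancedCode Kneg Kpos R)∗) : ∀ s t, w ≠ Sum.inl s :: t := by
  refine kstar_induction (P := fun w => ∀ s t, w ≠ Sum.inl s :: t) (by simp) ?_ hw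
  rintro _ ⟨γ, k, k', m, r, hm, hr, rfl⟩ t - - s t'
  simp

/-- A nonempty proper suffix of a codeword that contains the outer closing symbol has negative
height, unlike a prefix of a neutral word. One that starts behind this symbol begins with a letter
of `S`, whereas codewords begin with a loop. -/
theorem isCircularCode_balancedCode (h0 : [] ∈ R) :
    IsCircularCode (balancedCode Kneg Kpos R) where
  nil_notMem := by rintro ⟨γ, k, k', m, r, -, -, h⟩; simp at h
  suffix := by
    rintro a b t ha hb ⟨γ, k, k', m, r, hm, hr, h⟩ ht
    cases a with
    | nil => exact ha rfl
    | cons x a =>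
      rw [List.cons_append, List.cons.injEq] at h
      obtain ⟨-, h⟩ := h
      have hb0 := (Neutral.of_mem_kstar_balanced h0 ht).height_prefix_nonneg _ _ rfl
      rcases List.append_eq_append_iff.1 h with ⟨z, rfl, rfl⟩ | ⟨z, rfl, h2⟩
      · have h1 := hm.height_prefix_nonneg _ _ rfl
        have h2 := hm.height_eq_zero
        simp only [height_append, height_pos_cons, height_map_inl] at hb0 h2
        omega
      · cases z with
        | nil =>
          rw [List.nil_append] at h2
          subst h2
          simp at hb0
        | cons x z =>
          rw [List.cons_append, List.cons.injEq] at h2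
          obtain ⟨z', b', -, rfl, rfl⟩ := List.map_eq_append_iff.1 h2.2
          cases b' with
          | nil => exact hb rfl
          | cons s b' => exact head_of_mem_kstar_balanced ht _ _ rfl

end Codes

/-! ### Normal forms of admissible and of cyclically admissible words -/

section Decomposition
variable {S Γ : Type*} {Kneg Kpos : Γ → ℕ} {R : Language S}

/-- A Dyck symbol, followed by a word of `R`. -/
def loopCode (Kneg Kpos : Γ → ℕ) (R : Language S) : Language (S ⊕ DyckLoop Kneg Kpos) :=
  {w | ∃ (d : DyckLoop Kneg Kpos) (r : List S), r ∈ R ∧ w = Sum.inr d :: r.map Sum.inl}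

/-- The neutral word `b` is absorbed by the last codeword of `n`, or by `m` if `n` is empty. -/
theorem exists_neutral_append_kstar_negCode (hR : ∀ r ∈ R, ∀ r' ∈ R, r ++ r' ∈ R)
    {m n b : List (S ⊕ DyckLoop Kneg Kpos)} (hm : Neutral Kneg Kpos R m)
    (hn : n ∈ (negCode Kneg Kpos R)∗) (hb : Neutral Kneg Kpos R b) :
    ∃ m' n', Neutral Kneg Kpos R m' ∧ n' ∈ (negCode Kneg Kpos R)∗ ∧ m ++ n ++ b = m' ++ n' := by
  refine kstar_induction_right (P := fun n => ∃ m' n', Neutral Kneg Kpos R m' ∧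
    n' ∈ (negCode Kneg Kpos R)∗ ∧ m ++ n ++ b = m' ++ n') ?_ ?_ hn
  · exact ⟨m ++ b, [], hm.append hR hb, Language.nil_mem_kstar _, by simp⟩
  · rintro _ ⟨γ, k, m1, hm1, rfl⟩ n0 hn0 -
    exact ⟨m, n0 ++ (Sum.inr (DyckLoop.neg γ k) :: (m1 ++ b)), hm,
      append_mem_kstar hn0 (mem_kstar_of_mem ⟨γ, k, _, hm1.append hR hb, rfl⟩), by simp⟩

theorem eq_of_wordValue_bracket_ne_zero {γ γ' : Γ} {k : Fin (Kneg γ)} {k' : Fin (Kpos γ')}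
    {u m w : List (S ⊕ DyckLoop Kneg Kpos)} (hm : wordValue m = 1)
    (h : wordValue (u ++ Sum.inr (DyckLoop.neg γ k) :: (m ++ Sum.inr (DyckLoop.pos γ' k') :: w)) ≠
      DyckMonoid.zero Γ) : γ = γ' := by
  by_contra hne
  apply h
  simp only [wordValue_append, wordValue_neg_cons, wordValue_pos_cons, hm, one_mul]
  rw [← mul_assoc (DyckMonoid.of _), DyckMonoid.neg_mul_pos_of_ne hne, DyckMonoid.zero_mul,
    DyckMonoid.mul_zero]

/-- The normal form of the admissible words. -/
theorem exists_normal_form (h0 : [] ∈ R) (hR : ∀ r ∈ R, ∀ r' ∈ R, r ++ r' ∈ R) {r : List S}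
    (hr : r ∈ R) {t : List (S ⊕ DyckLoop Kneg Kpos)} (ht : t ∈ (loopCode Kneg Kpos R)∗) :
    wordValue (r.map Sum.inl ++ t) ≠ DyckMonoid.zero Γ →
    ∃ p m n, p ∈ (posCode Kneg Kpos R)∗ ∧ Neutral Kneg Kpos R m ∧ n ∈ (negCode Kneg Kpos R)∗ ∧
      r.map Sum.inl ++ t = p ++ m ++ n := by
  refine kstar_induction_right (P := fun t => wordValue (r.map Sum.inl ++ t) ≠ DyckMonoid.zero Γ →
    ∃ p m n, p ∈ (posCode Kneg Kpos R)∗ ∧ Neutral Kneg Kpos R m ∧ n ∈ (negCode Kneg Kpos R)∗ ∧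
      r.map Sum.inl ++ t = p ++ m ++ n) ?_ ?_ ht
  · exact fun _ => ⟨[], _, [], Language.nil_mem_kstar _, .base r hr, Language.nil_mem_kstar _,
      by simp⟩
  · rintro _ ⟨d, r', hr', rfl⟩ t - ih hv
    rw [← List.append_assoc] at hv ⊢
    have hv' : wordValue (r.map Sum.inl ++ t) ≠ DyckMonoid.zero Γ := by
      intro h
      rw [wordValue_append, h, DyckMonoid.zero_mul] at hv
      exact hv rfl
    obtain ⟨p, m, n, hp, hm, hn, h⟩ := ih hv'
    rw [h] at hv ⊢
    cases d with
    | neg γ k =>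
      exact ⟨p, m, n ++ (Sum.inr (DyckLoop.neg γ k) :: r'.map Sum.inl), hp, hm,
        append_mem_kstar hn (mem_kstar_of_mem ⟨γ, k, _, .base r' hr', rfl⟩), by simp⟩
    | pos γ k =>
      -- The new `γ(+)` meets the last uncancelled `γ(-)`. If there is none, it closes a word of
      -- `posCode` together with `m`; otherwise the two must match and form a neutral word.
      revert hv
      refine kstar_induction_right (P := fun n => wordValue (p ++ m ++ n ++
        Sum.inr (DyckLoop.pos γ k) :: r'.map Sum.inl) ≠ DyckMonoid.zero Γ →
        ∃ p' m' n', p' ∈ (posCode Kneg Kpos R)∗ ∧ Neutral Kneg Kpos R m' ∧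
          n' ∈ (negCode Kneg Kpos R)∗ ∧
          p ++ m ++ n ++ Sum.inr (DyckLoop.pos γ k) :: r'.map Sum.inl = p' ++ m' ++ n') ?_ ?_ hn
      · exact fun _ => ⟨p ++ (m ++ [Sum.inr (DyckLoop.pos γ k)]), r'.map Sum.inl, [],
          append_mem_kstar hp (mem_kstar_of_mem ⟨γ, k, m, hm, rfl⟩), .base r' hr',
          Language.nil_mem_kstar _, by simp⟩
      · rintro _ ⟨γ', k', m1, hm1, rfl⟩ n0 hn0 - hv
        obtain rfl : γ' = γ := eq_of_wordValue_bracket_ne_zero (k := k') (k' := k)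
          (u := p ++ m ++ n0) (m := m1) (w := r'.map Sum.inl) hm1.wordValue_eq_one
          (by simpa [-wordValue_append, -wordValue_neg_cons, -wordValue_pos_cons] using hv)
        obtain ⟨m', n', hm', hn', hmn⟩ := exists_neutral_append_kstar_negCode hR hm hn0
          (.step [] m1 γ' k' k r' (.base [] h0) hm1 hr')
        refine ⟨p, m', n', hp, hm', hn', ?_⟩
        rw [List.append_assoc p m', ← hmn]
        simp

/-- The powers of the word have nonzero value. -/
def CyclicallyAdmissible (w : List (S ⊕ DyckLoop Kneg Kpos)) : Prop :=
  ∀ m, wordValue (List.replicate m w).flatten ≠ DyckMonoid.zero Γ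

theorem CyclicallyAdmissible.of_isRotated {w w' : List (S ⊕ DyckLoop Kneg Kpos)}
    (h : CyclicallyAdmissible w) (hw : w ~r w') : CyclicallyAdmissible w' :=
  IsFactorial.replicate_rotated (L := {w | MotzkinAdmissible w})
    (fun _ _ _ => motzkinAdmissible_of_append) hw h

/-- Induction on the number of codewords in `n`. If `p` and `n` are both nonempty, the last codeword
of `n`, rotated to the front, cancels with the first of `p`, which shortens `n`. If one of them is
empty, `m` is rotated into a codeword of the other. -/
theorem isRotated_normal_form_aux (h0 : [] ∈ R) (hR : ∀ r ∈ R, ∀ r' ∈ R, r ++ r' ∈ R)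
    {n : List (S ⊕ DyckLoop Kneg Kpos)} (hn : n ∈ (negCode Kneg Kpos R)∗) :
    ∀ p ∈ (posCode Kneg Kpos R)∗, ∀ m, Neutral Kneg Kpos R m →
      CyclicallyAdmissible (p ++ m ++ n) → ∃ w, p ++ m ++ n ~r w ∧
        (w ∈ (posCode Kneg Kpos R)∗ ∨ Neutral Kneg Kpos R w ∨ w ∈ (negCode Kneg Kpos R)∗) := by
  refine kstar_induction_right (P := fun n => ∀ p ∈ (posCode Kneg Kpos R)∗, ∀ m,
    Neutral Kneg Kpos R m → CyclicallyAdmissible (p ++ m ++ n) → ∃ w, p ++ m ++ n ~r w ∧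
      (w ∈ (posCode Kneg Kpos R)∗ ∨ Neutral Kneg Kpos R w ∨ w ∈ (negCode Kneg Kpos R)∗)) ?_ ?_ hn
  · intro p hp m hm _
    rw [List.append_nil]
    refine kstar_induction (P := fun p => ∃ w, p ++ m ~r w ∧
      (w ∈ (posCode Kneg Kpos R)∗ ∨ Neutral Kneg Kpos R w ∨ w ∈ (negCode Kneg Kpos R)∗)) ?_ ?_ hp
    · exact ⟨m, List.IsRotated.refl m, Or.inr (Or.inl hm)⟩
    · rintro _ ⟨γ, k, m', hm', rfl⟩ p hp -
      refine ⟨_, List.isRotated_append, Or.inl ?_⟩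
      have := append_mem_kstar (mem_kstar_of_mem (C := posCode Kneg Kpos R)
        ⟨γ, k, m ++ m', hm.append hR hm', rfl⟩) hp
      simpa using this
  · rintro _ ⟨γ, k, m1, hm1, rfl⟩ n0 hn0 ih p hp m hm
    refine kstar_induction (P := fun p => CyclicallyAdmissible (p ++ m ++
        (n0 ++ Sum.inr (DyckLoop.neg γ k) :: m1)) → ∃ w, p ++ m ++ (n0 ++
          Sum.inr (DyckLoop.neg γ k) :: m1) ~r w ∧ (w ∈ (posCode Kneg Kpos R)∗ ∨
          Neutral Kneg Kpos R w ∨ w ∈ (negCode Kneg Kpos R)∗)) ?_ ?_ hp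
    · intro _
      refine ⟨_, List.isRotated_append (l := [] ++ m), Or.inr (Or.inr ?_)⟩
      have := append_mem_kstar hn0 (mem_kstar_of_mem (C := negCode Kneg Kpos R)
        ⟨γ, k, m1 ++ m, hm1.append hR hm, rfl⟩)
      simpa using this
    · rintro _ ⟨γ', k', m2, hm2, rfl⟩ p0 hp0 - hadm
      have hrot : m2 ++ [Sum.inr (DyckLoop.pos γ' k')] ++ p0 ++ m ++
          (n0 ++ Sum.inr (DyckLoop.neg γ k) :: m1) ~r
          Sum.inr (DyckLoop.neg γ k) :: (m1 ++ m2 ++ Sum.inr (DyckLoop.pos γ' k') :: []) ++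
            (p0 ++ m ++ n0) := by
        have := List.isRotated_append (l := m2 ++ [Sum.inr (DyckLoop.pos γ' k')] ++ p0 ++ m ++ n0)
          (l' := Sum.inr (DyckLoop.neg γ k) :: m1)
        simpa using this
      have hadm' := hadm.of_isRotated hrot
      obtain rfl : γ = γ' := by
        refine eq_of_wordValue_bracket_ne_zero (k := k) (k' := k') (u := []) (m := m1 ++ m2)
          (w := p0 ++ m ++ n0) (hm1.append hR hm2).wordValue_eq_one ?_
        simpa [-wordValue_append, -wordValue_neg_cons, -wordValue_pos_cons] using hadm' 1
      have hb : Neutral Kneg Kpos R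
          (Sum.inr (DyckLoop.neg γ k) :: (m1 ++ m2 ++ Sum.inr (DyckLoop.pos γ k') :: [])) := by
        simpa using Neutral.step [] _ γ k k' [] (.base [] h0) (hm1.append hR hm2) h0
      generalize Sum.inr (DyckLoop.neg γ k) :: (m1 ++ m2 ++ Sum.inr (DyckLoop.pos γ k') :: []) = b
        at hb hrot hadm'
      -- The neutral word `b` just formed is absorbed by the first codeword of `p0`, or by `m` if
      -- `p0` is empty.
      obtain ⟨p', m', hp', hm', h'⟩ : ∃ p' m', p' ∈ (posCode Kneg Kpos R)∗ ∧
          Neutral Kneg Kpos R m' ∧ b ++ (p0 ++ m) = p' ++ m' := by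
        refine kstar_induction (P := fun p0 => ∃ p' m', p' ∈ (posCode Kneg Kpos R)∗ ∧
          Neutral Kneg Kpos R m' ∧ b ++ (p0 ++ m) = p' ++ m') ?_ ?_ hp0
        · exact ⟨[], b ++ m, Language.nil_mem_kstar _, hb.append hR hm, by simp⟩
        · rintro _ ⟨γ3, k3, m3, hm3, rfl⟩ p3 hp3 -
          refine ⟨_, m, append_mem_kstar (mem_kstar_of_mem (C := posCode Kneg Kpos R)
            ⟨γ3, k3, b ++ m3, hb.append hR hm3, rfl⟩) hp3, hm, by simp⟩
      rw [← List.append_assoc b, h'] at hrot hadm'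
      obtain ⟨w, hw, hw'⟩ := ih p' hp' m' hm' hadm'
      exact ⟨w, hrot.trans hw, hw'⟩

/-- A cyclically admissible word that is not a word over `S` is a rotation of a concatenation of
codewords of one of the three codes. -/
theorem mem_rotations_of_cyclicallyAdmissible (h0 : [] ∈ R)
    (hR : ∀ r ∈ R, ∀ r' ∈ R, r ++ r' ∈ R) {t : List (S ⊕ DyckLoop Kneg Kpos)}
    (ht : t ∈ (loopCode Kneg Kpos R)∗) (hd : ∃ d, Sum.inr d ∈ t)
    (hadm : CyclicallyAdmissible t) :
    t ∈ rotations (posCode Kneg Kpos R) ∨ t ∈ rotations (balancedCode Kneg Kpos R) ∨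
      t ∈ rotations (negCode Kneg Kpos R) := by
  obtain ⟨d, hd⟩ := hd
  have hne : t ≠ [] := List.ne_nil_of_mem hd
  obtain ⟨p, m, n, hp, hm, hn, h⟩ := exists_normal_form h0 hR h0 ht
    (by simpa [-wordValue_append] using hadm 1)
  rw [List.map_nil, List.nil_append] at h
  obtain ⟨w, hw, h1⟩ := isRotated_normal_form_aux h0 hR hn p hp m hm (h ▸ hadm)
  rw [← h] at hw
  rcases h1 with h1 | h1 | h1
  · exact Or.inl (mem_rotations_of_isRotated hne hw h1)
  · refine Or.inr (Or.inl ?_)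
    -- The leading word of `R` is rotated to the end, where it merges with the final `R`-word of the
    -- last codeword. There is a last codeword because `c` contains the loop `d`.
    obtain ⟨r, hr, c, hc, rfl⟩ := h1.exists_eq_append_balanced
    replace hd : Sum.inr d ∈ r.map Sum.inl ++ c := hw.mem_iff.1 hd
    have hdc : Sum.inr d ∈ c := by simpa using hd
    refine mem_rotations_of_isRotated hne (hw.trans List.isRotated_append) ?_
    revert hdc
    refine kstar_induction_right (P := fun c => Sum.inr d ∈ c →
      c ++ r.map Sum.inl ∈ (balancedCode Kneg Kpos R)∗) (by simp) ?_ hc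
    rintro _ ⟨γ, k, k', m, r', hm, hr', rfl⟩ c hc - -
    have := append_mem_kstar hc (mem_kstar_of_mem (C := balancedCode Kneg Kpos R)
      ⟨γ, k, k', m, r' ++ r, hm, hR _ hr' _ hr, rfl⟩)
    simpa using this
  · exact Or.inr (Or.inr (mem_rotations_of_isRotated hne hw h1))

/-- The value has a right inverse, made of the matching `γ(+)`. For `posCode` there is a left
inverse. -/
theorem wordValue_kstar_negCode_ne_zero {w : List (S ⊕ DyckLoop Kneg Kpos)}
    (hw : w ∈ (negCode Kneg Kpos R)∗) : wordValue w ≠ DyckMonoid.zero Γ := by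
  obtain ⟨b, hb⟩ : ∃ b, wordValue w * b = 1 := by
    refine kstar_induction (P := fun w => ∃ b, wordValue w * b = 1) ⟨1, by simp⟩ ?_ hw
    rintro _ ⟨γ, k, m, hm, rfl⟩ r - ⟨b, hb⟩
    refine ⟨b * DyckMonoid.of (DyckGen.pos γ), ?_⟩
    rw [wordValue_append, wordValue_neg_cons, hm.wordValue_eq_one, mul_one, mul_assoc,
      ← mul_assoc (wordValue r), hb, one_mul, DyckMonoid.neg_mul_pos]
  exact (DyckMonoid.ne_zero_of_mul_eq_one hb).1

theorem wordValue_kstar_posCode_ne_zero {w : List (S ⊕ DyckLoop Kneg Kpos)}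
    (hw : w ∈ (posCode Kneg Kpos R)∗) : wordValue w ≠ DyckMonoid.zero Γ := by
  obtain ⟨b, hb⟩ : ∃ b, b * wordValue w = 1 := by
    refine kstar_induction_right (P := fun w => ∃ b, b * wordValue w = 1) ⟨1, by simp⟩ ?_ hw
    rintro _ ⟨γ, k, m, hm, rfl⟩ r - ⟨b, hb⟩
    refine ⟨DyckMonoid.of (DyckGen.neg γ) * b, ?_⟩
    rw [wordValue_append, wordValue_append, hm.wordValue_eq_one, wordValue_pos_cons, one_mul,
      wordValue_nil, mul_one, mul_assoc, ← mul_assoc b, hb, one_mul, DyckMonoid.neg_mul_pos]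
  exact (DyckMonoid.ne_zero_of_mul_eq_one hb).2

theorem wordValue_kstar_balancedCode_ne_zero (h0 : [] ∈ R)
    {w : List (S ⊕ DyckLoop Kneg Kpos)} (hw : w ∈ (balancedCode Kneg Kpos R)∗) :
    wordValue w ≠ DyckMonoid.zero Γ := by
  rw [(Neutral.of_mem_kstar_balanced h0 hw).wordValue_eq_one]
  exact DyckMonoid.one_ne_zero

end Decomposition

/-! ### Periodic words of the graph with attached loops -/

namespace LabeledGraph
variable {V E S Γ : Type*} (G : LabeledGraph V E S) (v : V) {Kneg Kpos : Γ → ℕ}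

/-- The label sequences of the return paths at `v`. -/
def returnLabels : Language S := {r | ∃ p, G.IsPath v p v ∧ p.map G.label = r}

theorem nil_mem_returnLabels : [] ∈ G.returnLabels v := ⟨[], rfl, rfl⟩

theorem append_mem_returnLabels : ∀ r ∈ G.returnLabels v, ∀ r' ∈ G.returnLabels v,
    r ++ r' ∈ G.returnLabels v := by
  rintro _ ⟨p, hp, rfl⟩ _ ⟨p', hp', rfl⟩
  exact ⟨p ++ p', (G.isPath_append).2 ⟨v, hp, hp'⟩, by simp⟩

theorem isPath_attachLoops_map_inl {u w : V} {p : List E} :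
    (G.attachLoops v Kneg Kpos).IsPath u (p.map Sum.inl) w ↔ G.IsPath u p w := by
  induction p generalizing u with
  | nil => simp [IsPath]
  | cons e p ih => exact and_congr Iff.rfl ih

theorem map_label_attachLoops_map_inl (p : List E) :
    (p.map Sum.inl).map (G.attachLoops v Kneg Kpos).label = (p.map G.label).map Sum.inl := by
  simp [attachLoops]

theorem exists_eq_map_inl_of_map_label {q : List (E ⊕ DyckLoop Kneg Kpos)} {w : List S}
    (h : q.map (G.attachLoops v Kneg Kpos).label = w.map Sum.inl) :
    ∃ p : List E, q = p.map Sum.inl ∧ p.map G.label = w := by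
  induction q generalizing w with
  | nil =>
    cases w with
    | nil => exact ⟨[], rfl, rfl⟩
    | cons s w => simp at h
  | cons e q ih =>
    cases w with
    | nil => simp at h
    | cons s w =>
      simp only [List.map_cons, List.cons.injEq] at h
      obtain ⟨p, rfl, rfl⟩ := ih h.2
      cases e with
      | inl e => exact ⟨e :: p, rfl, by simpa [attachLoops] using h.1⟩
      | inr d => simp [attachLoops] at h

theorem map_inl_mem_attachedLanguage_iff {w : List S} :
    w.map Sum.inl ∈ G.attachedLanguage v Kneg Kpos ↔ w ∈ G.pathLabels := by
  constructor
  · rintro ⟨u, u', q, hq, h, -⟩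
    obtain ⟨p, rfl, rfl⟩ := G.exists_eq_map_inl_of_map_label v h
    exact ⟨u, u', p, (G.isPath_attachLoops_map_inl v).1 hq, rfl⟩
  · rintro ⟨u, u', p, hp, rfl⟩
    refine ⟨u, u', p.map Sum.inl, (G.isPath_attachLoops_map_inl v).2 hp,
      G.map_label_attachLoops_map_inl v p, ?_⟩
    rw [motzkinAdmissible_iff, wordValue_map_inl]
    exact DyckMonoid.one_ne_zero

theorem isFactorial_attachedLanguage : IsFactorial (G.attachedLanguage v Kneg Kpos) := by
  rintro a w t ⟨u, u', p, hp, h, hadm⟩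
  obtain ⟨p', p3, rfl, h', rfl⟩ := List.map_eq_append_iff.1 h
  obtain ⟨p1, p2, rfl, rfl, rfl⟩ := List.map_eq_append_iff.1 h'
  obtain ⟨x, hx, -⟩ := (isPath_append _).1 hp
  obtain ⟨y, -, hy⟩ := (isPath_append _).1 hx
  exact ⟨y, x, p2, hy, rfl, motzkinAdmissible_of_append hadm⟩

theorem periodicCount_attachedShift {n : ℕ} (hn : n ≠ 0) :
    periodicCount (G.attachedShift v Kneg Kpos) n =
      (periodicWords (G.attachedLanguage v Kneg Kpos) n).ncard :=
  periodicCount_eq_ncard_periodicWords hn fun _ hx =>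
    forall_window_mem_iff (G.isFactorial_attachedLanguage v) hn hx

/-- The label sequences of the return paths at `v` in the graph with attached loops. -/
def attachedReturnLabels (Kneg Kpos : Γ → ℕ) : Language (S ⊕ DyckLoop Kneg Kpos) :=
  (G.attachLoops v Kneg Kpos).returnLabels v

theorem map_inl_mem_attachedReturnLabels {r : List S} (hr : r ∈ G.returnLabels v) :
    r.map Sum.inl ∈ G.attachedReturnLabels v Kneg Kpos := by
  obtain ⟨p, hp, rfl⟩ := hr
  exact ⟨p.map Sum.inl, (G.isPath_attachLoops_map_inl v).2 hp,
    G.map_label_attachLoops_map_inl v p⟩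

theorem cons_inr_mem_attachedReturnLabels (d : DyckLoop Kneg Kpos)
    {w : List (S ⊕ DyckLoop Kneg Kpos)} (hw : w ∈ G.attachedReturnLabels v Kneg Kpos) :
    Sum.inr d :: w ∈ G.attachedReturnLabels v Kneg Kpos := by
  obtain ⟨p, hp, rfl⟩ := hw
  exact ⟨Sum.inr d :: p, ⟨rfl, hp⟩, rfl⟩

theorem append_mem_attachedReturnLabels {u w : List (S ⊕ DyckLoop Kneg Kpos)}
    (hu : u ∈ G.attachedReturnLabels v Kneg Kpos) (hw : w ∈ G.attachedReturnLabels v Kneg Kpos) :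
    u ++ w ∈ G.attachedReturnLabels v Kneg Kpos :=
  append_mem_returnLabels _ v _ hu _ hw

theorem kstar_subset_attachedReturnLabels {C : Language (S ⊕ DyckLoop Kneg Kpos)}
    (hC : ∀ c ∈ C, c ∈ G.attachedReturnLabels v Kneg Kpos) {w : List (S ⊕ DyckLoop Kneg Kpos)}
    (hw : w ∈ C∗) : w ∈ G.attachedReturnLabels v Kneg Kpos :=
  kstar_induction (P := fun w => w ∈ G.attachedReturnLabels v Kneg Kpos)
    (nil_mem_returnLabels _ v)
    (fun c hc _ _ hr => G.append_mem_attachedReturnLabels v (hC c hc) hr) hw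

theorem neutral_mem_attachedReturnLabels {w : List (S ⊕ DyckLoop Kneg Kpos)}
    (hw : Neutral Kneg Kpos (G.returnLabels v) w) :
    w ∈ G.attachedReturnLabels v Kneg Kpos := by
  induction hw with
  | base r hr => exact G.map_inl_mem_attachedReturnLabels v hr
  | step u m γ k k' r hu hm hr ihu ihm =>
    exact G.append_mem_attachedReturnLabels v ihu (G.cons_inr_mem_attachedReturnLabels v _
      (G.append_mem_attachedReturnLabels v ihm (G.cons_inr_mem_attachedReturnLabels v _
        (G.map_inl_mem_attachedReturnLabels v hr))))

theorem mem_periodicWords_of_mem_rotations {C : Language (S ⊕ DyckLoop Kneg Kpos)}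
    (hC : ∀ c ∈ C, c ∈ G.attachedReturnLabels v Kneg Kpos)
    (hadm : ∀ w ∈ C∗, wordValue w ≠ DyckMonoid.zero Γ) {w : List (S ⊕ DyckLoop Kneg Kpos)}
    (hw : w ∈ rotations C) :
    w ∈ periodicWords (G.attachedLanguage v Kneg Kpos) w.length := by
  obtain ⟨w', hrot, hw', -⟩ := isRotated_of_mem_rotations hw
  refine ⟨rfl, (G.isFactorial_attachedLanguage v).replicate_rotated hrot.symm fun m => ?_⟩
  have h := replicate_flatten_mem_kstar hw' m
  obtain ⟨p, hp, hpl⟩ := G.kstar_subset_attachedReturnLabels v hC h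
  exact ⟨v, v, p, hp, hpl, hadm _ h⟩

/-- The path is cut at each attached loop; all the pieces between loops return to `v`. -/
theorem exists_labels_of_isPath_attachLoops {u : V} {p : List (E ⊕ DyckLoop Kneg Kpos)}
    (hp : (G.attachLoops v Kneg Kpos).IsPath u p v) :
    ∃ q t, G.IsPath u q v ∧ t ∈ (loopCode Kneg Kpos (G.returnLabels v))∗ ∧
      p.map (G.attachLoops v Kneg Kpos).label = (q.map G.label).map Sum.inl ++ t := by
  induction p generalizing u with
  | nil => exact ⟨[], [], hp, Language.nil_mem_kstar _, rfl⟩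
  | cons e p ih =>
    obtain ⟨h1, h2⟩ := hp
    obtain ⟨q, t, hq, ht, h⟩ := ih h2
    cases e with
    | inl e => exact ⟨e :: q, t, ⟨h1, hq⟩, ht, by rw [List.map_cons, h]; rfl⟩
    | inr d =>
      obtain rfl : v = u := h1
      refine ⟨[], Sum.inr d :: (q.map G.label).map Sum.inl ++ t, rfl,
        append_mem_kstar (mem_kstar_of_mem ⟨d, _, ⟨q, hq, rfl⟩, rfl⟩) ht, ?_⟩
      rw [List.map_cons, h]
      rfl

/-- In a path labeled by the square of the word, both copies start with a loop, hence at `v`. So the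
first copy is a closed path at `v`. -/
theorem mem_kstar_loopCode_of_periodicWords {n : ℕ} {d : DyckLoop Kneg Kpos}
    {w : List (S ⊕ DyckLoop Kneg Kpos)}
    (hw : Sum.inr d :: w ∈ periodicWords (G.attachedLanguage v Kneg Kpos) n) :
    Sum.inr d :: w ∈ (loopCode Kneg Kpos (G.returnLabels v))∗ := by
  obtain ⟨u, u', p, hp, h, -⟩ := hw.2 2
  simp only [List.replicate_succ, List.replicate_zero, List.flatten_cons, List.flatten_nil,
    List.append_nil] at h
  obtain ⟨p1, p2, rfl, h1, h2⟩ := List.map_eq_append_iff.1 h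
  obtain ⟨x, hx1, hx2⟩ := (isPath_append _).1 hp
  have start : ∀ {y y' : V} {p : List (E ⊕ DyckLoop Kneg Kpos)},
      (G.attachLoops v Kneg Kpos).IsPath y p y' →
      p.map (G.attachLoops v Kneg Kpos).label = Sum.inr d :: w → y = v := by
    intro y y' p hp hpl
    cases p with
    | nil => simp at hpl
    | cons e p =>
      cases e with
      | inl e => simp [attachLoops] at hpl
      | inr d' => exact hp.1.symm
  obtain rfl := start hx1 h1
  obtain rfl := start hx2 h2
  cases p1 with
  | nil => simp at h1
  | cons e p1 =>
    obtain ⟨-, hx1⟩ := hx1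
    cases e with
    | inl e => simp [attachLoops] at h1
    | inr d' =>
      obtain ⟨q, t, hq, ht, hl⟩ := G.exists_labels_of_isPath_attachLoops _ hx1
      rw [← h1, List.map_cons, hl]
      exact append_mem_kstar (C := loopCode Kneg Kpos (G.returnLabels x))
        (mem_kstar_of_mem ⟨d', _, ⟨q, hq, rfl⟩, rfl⟩) ht

/-- A word containing a loop symbol is rotated to start with one, classified by
`mem_rotations_of_cyclicallyAdmissible`, and rotated back. -/
theorem periodicWords_attachedLanguage {n : ℕ} (hn : n ≠ 0) :
    periodicWords (G.attachedLanguage v Kneg Kpos) n =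
      List.map Sum.inl '' periodicWords G.pathLabels n ∪
        ({w | w ∈ rotations (balancedCode Kneg Kpos (G.returnLabels v)) ∧ w.length = n} ∪
        ({w | w ∈ rotations (negCode Kneg Kpos (G.returnLabels v)) ∧ w.length = n} ∪
        {w | w ∈ rotations (posCode Kneg Kpos (G.returnLabels v)) ∧ w.length = n})) := by
  have h0 := G.nil_mem_returnLabels v
  have map_flatten : ∀ (w : List S) (m : ℕ), (List.replicate m (w.map
      (Sum.inl : S → S ⊕ DyckLoop Kneg Kpos))).flatten =
      (List.replicate m w).flatten.map Sum.inl := by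
    intro w m
    rw [List.map_flatten, List.map_replicate]
  ext w
  constructor
  · intro hw
    by_cases hd : ∃ d, Sum.inr d ∈ w
    · right
      obtain ⟨d, hd⟩ := hd
      obtain ⟨a, b, rfl⟩ := List.append_of_mem hd
      have hrot := List.isRotated_append (l := a) (l' := Sum.inr d :: b)
      have hw' : Sum.inr d :: b ++ a ∈ periodicWords (G.attachedLanguage v Kneg Kpos) n :=
        ⟨hrot.perm.length_eq ▸ hw.1,
          (G.isFactorial_attachedLanguage v).replicate_rotated hrot hw.2⟩
      have hrots : ∀ C : Language (S ⊕ DyckLoop Kneg Kpos), Sum.inr d :: b ++ a ∈ rotations C →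
          a ++ Sum.inr d :: b ∈ rotations C := by
        intro C h
        obtain ⟨w', h1, h2, -⟩ := isRotated_of_mem_rotations h
        exact mem_rotations_of_isRotated (by simp) (hrot.trans h1) h2
      have := mem_rotations_of_cyclicallyAdmissible h0 (G.append_mem_returnLabels v)
        (G.mem_kstar_loopCode_of_periodicWords v hw') ⟨d, by simp⟩ (fun m => by
          obtain ⟨_, _, _, _, _, h⟩ := hw'.2 m
          exact h)
      rcases this with h | h | h
      · exact Or.inr (Or.inr ⟨hrots _ h, hw.1⟩)
      · exact Or.inl ⟨hrots _ h, hw.1⟩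
      · exact Or.inr (Or.inl ⟨hrots _ h, hw.1⟩)
    · left
      obtain ⟨w, rfl⟩ : ∃ w', w = List.map Sum.inl w' := by
        have h : w ∈ Set.range (List.map Sum.inl) := by
          rw [Set.range_list_map]
          intro x hx
          cases x with
          | inl s => exact ⟨s, rfl⟩
          | inr d => exact (hd ⟨d, hx⟩).elim
        obtain ⟨w', h⟩ := h
        exact ⟨w', h.symm⟩
      refine ⟨w, ⟨by simpa using hw.1, fun m => ?_⟩, rfl⟩
      rw [← G.map_inl_mem_attachedLanguage_iff v (Kneg := Kneg) (Kpos := Kpos), ← map_flatten]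
      exact hw.2 m
  · rintro (⟨w, hw, rfl⟩ | ⟨hw, rfl⟩ | ⟨hw, rfl⟩ | ⟨hw, rfl⟩)
    · refine ⟨by simpa using hw.1, fun m => ?_⟩
      rw [map_flatten, G.map_inl_mem_attachedLanguage_iff v]
      exact hw.2 m
    · refine G.mem_periodicWords_of_mem_rotations v ?_
        (fun _ => wordValue_kstar_balancedCode_ne_zero h0) hw
      rintro _ ⟨γ, k, k', m, r, hm, hr, rfl⟩
      have := G.neutral_mem_attachedReturnLabels v (.step [] m γ k k' r (.base [] h0) hm hr)
      simpa using this
    · refine G.mem_periodicWords_of_mem_rotations v ?_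
        (fun _ => wordValue_kstar_negCode_ne_zero) hw
      rintro _ ⟨γ, k, m, hm, rfl⟩
      exact G.cons_inr_mem_attachedReturnLabels v _ (G.neutral_mem_attachedReturnLabels v hm)
    · refine G.mem_periodicWords_of_mem_rotations v ?_
        (fun _ => wordValue_kstar_posCode_ne_zero) hw
      rintro _ ⟨γ, k, m, hm, rfl⟩
      exact G.append_mem_attachedReturnLabels v (G.neutral_mem_attachedReturnLabels v hm)
        (G.cons_inr_mem_attachedReturnLabels v _ (nil_mem_returnLabels _ v))

end LabeledGraph

/-! ### Product formula for the zeta function and generating functions of the codes -/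

section Counting
variable {S Γ : Type*} {Kneg Kpos : Γ → ℕ} {R : Language S}

instance DyckLoop.finite [Finite Γ] : Finite (DyckLoop Kneg Kpos) :=
  Finite.of_surjective (α := (Σ γ, Fin (Kneg γ)) ⊕ (Σ γ, Fin (Kpos γ)))
    (Sum.elim (fun p => DyckLoop.neg p.1 p.2) fun p => DyckLoop.pos p.1 p.2) <| by
    rintro (⟨γ, k⟩ | ⟨γ, k⟩)
    · exact ⟨Sum.inl ⟨γ, k⟩, rfl⟩
    · exact ⟨Sum.inr ⟨γ, k⟩, rfl⟩

theorem one_le_height_of_mem_rotations_negCode {w : List (S ⊕ DyckLoop Kneg Kpos)}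
    (hw : w ∈ rotations (negCode Kneg Kpos R)) : 1 ≤ height w := by
  obtain ⟨w', hrot, hw', hne⟩ := isRotated_of_mem_rotations hw
  rw [height_eq_of_isRotated hrot]
  exact (height_kstar_negCode hw' w' [] (by simp)).2 hne

theorem height_le_of_mem_rotations_posCode {w : List (S ⊕ DyckLoop Kneg Kpos)}
    (hw : w ∈ rotations (posCode Kneg Kpos R)) : height w ≤ -1 := by
  obtain ⟨w', hrot, hw', hne⟩ := isRotated_of_mem_rotations hw
  rw [height_eq_of_isRotated hrot]
  exact (height_kstar_posCode hw' [] w' (by simp)).2 hne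

theorem height_of_mem_rotations_balancedCode (h0 : [] ∈ R)
    {w : List (S ⊕ DyckLoop Kneg Kpos)} (hw : w ∈ rotations (balancedCode Kneg Kpos R)) :
    height w = 0 := by
  obtain ⟨w', hrot, hw', -⟩ := isRotated_of_mem_rotations hw
  rw [height_eq_of_isRotated hrot]
  exact (Neutral.of_mem_kstar_balanced h0 hw').height_eq_zero

/-- Words without loops also have height `0`, so height does not separate them from this code; the
leading loop of a codeword does. -/
theorem map_inl_notMem_rotations_balancedCode {r : List S} :
    (r.map Sum.inl : List (S ⊕ DyckLoop Kneg Kpos)) ∉ rotations (balancedCode Kneg Kpos R) := by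
  intro h
  obtain ⟨w', hrot, hw', hne⟩ := isRotated_of_mem_rotations h
  cases w' with
  | nil => exact hne rfl
  | cons x t =>
    have hx : x ∈ (r.map Sum.inl : List (S ⊕ DyckLoop Kneg Kpos)) := hrot.mem_iff.2 (by simp)
    obtain ⟨s, -, rfl⟩ := List.mem_map.1 hx
    exact head_of_mem_kstar_balanced hw' _ _ rfl

/-- The number of words of length `n` in a language. -/
noncomputable def wordCount {A : Type*} (L : Language A) (n : ℕ) : ℕ :=
  {w : List A | w ∈ L ∧ w.length = n}.ncard

theorem exp_zetaExponent_wordCount_rotations {A : Type*} {C : Language A}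
    (h0 : [] ∉ C) (h : languageSeries (rotations C) * (1 - languageSeries C) =
      X * d⁄dX ℚ (languageSeries C)) :
    (PowerSeries.exp ℚ).subst (zetaExponent (wordCount (rotations C))) *
      (1 - languageSeries C) = 1 := by
  refine exp_subst_mul_one_sub (constantCoeff_zetaExponent _) ?_ ?_
  · rw [← PowerSeries.coeff_zero_eq_constantCoeff_apply]
    simp only [languageSeries, PowerSeries.coeff_mk, Nat.cast_eq_zero]
    convert Set.ncard_empty (List A)
    refine Set.eq_empty_of_forall_notMem fun w hw => h0 ?_
    rw [← List.length_eq_zero_iff.1 hw.2]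
    exact hw.1
  · rw [X_mul_derivative_zetaExponent]
    · exact h
    · have hempty : {w : List A | w ∈ rotations C ∧ w.length = 0} = ∅ :=
        Set.eq_empty_of_forall_notMem fun w hw => hw.1.1 (List.length_eq_zero_iff.1 hw.2)
      rw [wordCount, hempty, Set.ncard_empty]

theorem periodicCount_attachedShift_eq_add {V E : Type*} [Finite V] [Finite S] [Finite Γ]
    (G : LabeledGraph V E S) (v : V) {n : ℕ} (hn : n ≠ 0) :
    periodicCount (G.attachedShift v Kneg Kpos) n =
      periodicCount G.soficShift n +
        (wordCount (rotations (balancedCode Kneg Kpos (G.returnLabels v))) n +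
        (wordCount (rotations (negCode Kneg Kpos (G.returnLabels v))) n +
        wordCount (rotations (posCode Kneg Kpos (G.returnLabels v))) n)) := by
  have hfin : ∀ (T : Set (List (S ⊕ DyckLoop Kneg Kpos))), (∀ w ∈ T, w.length = n) → T.Finite :=
    fun T hT => (List.finite_length_eq _ n).subset hT
  rw [G.periodicCount_attachedShift v hn, G.periodicWords_attachedLanguage v hn,
    G.periodicCount_soficShift hn]
  rw [Set.ncard_union_eq ?_ ?_ ?_, Set.ncard_union_eq ?_ ?_ ?_, Set.ncard_union_eq ?_ ?_ ?_,
    Set.ncard_image_of_injective _ (List.map_injective_iff.2 Sum.inl_injective)]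
  · rfl
  · rw [Set.disjoint_left]
    rintro w ⟨h1, -⟩ ⟨h2, -⟩
    have := one_le_height_of_mem_rotations_negCode h1
    have := height_le_of_mem_rotations_posCode h2
    omega
  · exact hfin _ fun w hw => hw.2
  · exact hfin _ fun w hw => hw.2
  · rw [Set.disjoint_left]
    rintro w ⟨h1, -⟩ (⟨h2, -⟩ | ⟨h2, -⟩)
    · have := height_of_mem_rotations_balancedCode (G.nil_mem_returnLabels v) h1
      have := one_le_height_of_mem_rotations_negCode h2
      omega
    · have := height_of_mem_rotations_balancedCode (G.nil_mem_returnLabels v) h1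
      have := height_le_of_mem_rotations_posCode h2
      omega
  · exact hfin _ fun w hw => hw.2
  · exact hfin _ fun w hw => hw.elim (fun h => h.2) fun h => h.2
  · rw [Set.disjoint_left]
    rintro _ ⟨r, -, rfl⟩ (⟨h2, -⟩ | ⟨h2, -⟩ | ⟨h2, -⟩)
    · exact map_inl_notMem_rotations_balancedCode h2
    · have := one_le_height_of_mem_rotations_negCode h2
      simp at this
    · have := height_le_of_mem_rotations_posCode h2
      simp at this
  · refine hfin _ ?_
    rintro _ ⟨r, hr, rfl⟩
    simpa using hr.1
  · exact hfin _ fun w hw => by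
      rcases hw with h | h | h <;> exact h.2

theorem zetaSeries_attachedShift {V E : Type*} [Finite V] [Finite S] [Finite Γ]
    (G : LabeledGraph V E S) (v : V) :
    zetaSeries (G.attachedShift v Kneg Kpos) * (1 - languageSeries
      (balancedCode Kneg Kpos (G.returnLabels v))) * (1 - languageSeries
      (negCode Kneg Kpos (G.returnLabels v))) * (1 - languageSeries
      (posCode Kneg Kpos (G.returnLabels v))) = zetaSeries G.soficShift := by
  have h0 := G.nil_mem_returnLabels v
  have hb := isCircularCode_balancedCode (Kneg := Kneg) (Kpos := Kpos) h0
  have hn := isCircularCode_negCode (Kneg := Kneg) (Kpos := Kpos) (R := G.returnLabels v)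
  have hp := isCircularCode_reverse_posCode (Kneg := Kneg) (Kpos := Kpos) (R := G.returnLabels v)
  have hzb := exp_zetaExponent_wordCount_rotations hb.nil_notMem hb.languageSeries_rotations
  have hzn := exp_zetaExponent_wordCount_rotations hn.nil_notMem hn.languageSeries_rotations
  have hzp := exp_zetaExponent_wordCount_rotations (fun h => hp.nil_notMem (by simpa using h))
    hp.languageSeries_rotations_of_reverse
  have hsum : zetaExponent (periodicCount (G.attachedShift v Kneg Kpos)) =
      zetaExponent (periodicCount G.soficShift) +
        (zetaExponent (wordCount (rotations (balancedCode Kneg Kpos (G.returnLabels v)))) +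
        (zetaExponent (wordCount (rotations (negCode Kneg Kpos (G.returnLabels v)))) +
        zetaExponent (wordCount (rotations (posCode Kneg Kpos (G.returnLabels v)))))) := by
    ext n
    simp only [zetaExponent, map_add, PowerSeries.coeff_mk]
    rcases eq_or_ne n 0 with rfl | hn
    · simp
    · rw [periodicCount_attachedShift_eq_add G v hn]
      push_cast
      ring
  change (PowerSeries.exp ℚ).subst (zetaExponent _) * _ * _ * _ =
    (PowerSeries.exp ℚ).subst (zetaExponent _)
  rw [hsum, exp_subst_add, exp_subst_add, exp_subst_add]
  · have rearrange : ∀ y b n p b' n' p' : ℚ⟦X⟧, b * b' = 1 → n * n' = 1 → p * p' = 1 →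
        y * (b * (n * p)) * b' * n' * p' = y := by
      intro y b n p b' n' p' h1 h2 h3
      calc _ = y * (b * b') * (n * n') * (p * p') := by ring
        _ = y := by rw [h1, h2, h3, mul_one, mul_one, mul_one]
    exact rearrange _ _ _ _ _ _ _ hzb hzn hzp
  all_goals simp [constantCoeff_zetaExponent]

/-- The displayed loop is the last one in the word, which fixes the position of the cut. -/
theorem append_inr_cons_inj {m m' : List (S ⊕ DyckLoop Kneg Kpos)} {d d' : DyckLoop Kneg Kpos}
    {r r' : List S}
    (h : m ++ Sum.inr d :: r.map Sum.inl = m' ++ Sum.inr d' :: r'.map Sum.inl) :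
    m = m' ∧ d = d' ∧ r = r' := by
  have key : ∀ {z : List (S ⊕ DyckLoop Kneg Kpos)} {d d' : DyckLoop Kneg Kpos} {r r' : List S},
      Sum.inr d :: r.map Sum.inl = z ++ Sum.inr d' :: r'.map Sum.inl →
      z = [] ∧ d = d' ∧ r = r' := by
    intro z d d' r r' h
    cases z with
    | nil =>
      simp only [List.nil_append, List.cons.injEq, Sum.inr.injEq] at h
      exact ⟨rfl, h.1, List.map_injective_iff.2 Sum.inl_injective h.2⟩
    | cons x z =>
      have hd : Sum.inr d' ∈ (r.map Sum.inl : List (S ⊕ DyckLoop Kneg Kpos)) := by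
        rw [(List.cons.inj h).2]
        simp
      simp at hd
  rcases List.append_eq_append_iff.1 h with ⟨z, rfl, hz⟩ | ⟨z, rfl, hz⟩
  · obtain ⟨rfl, rfl, rfl⟩ := key hz
    simp
  · obtain ⟨rfl, rfl, rfl⟩ := key hz
    simp

variable [Finite S] [Fintype Γ]

theorem languageSeries_negCode :
    languageSeries (negCode Kneg Kpos R) =
      ((∑ γ, Kneg γ : ℕ) : ℚ⟦X⟧) * X * languageSeries (neutralLanguage Kneg Kpos R) := by
  have := finite_word_fiber (neutralLanguage Kneg Kpos R)
  let e : (Σ γ, Fin (Kneg γ)) × {w // w ∈ neutralLanguage Kneg Kpos R} →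
      {w // w ∈ negCode Kneg Kpos R} :=
    fun p => ⟨Sum.inr (DyckLoop.neg p.1.1 p.1.2) :: p.2.1, p.1.1, p.1.2, p.2.1, p.2.2, rfl⟩
  have he : Function.Bijective e := by
    constructor
    · rintro ⟨⟨γ, k⟩, m, hm⟩ ⟨⟨γ', k'⟩, m', hm'⟩ h
      have h := congrArg Subtype.val h
      simp only [e, List.cons.injEq, Sum.inr.injEq, DyckLoop.neg.injEq] at h
      obtain ⟨⟨rfl, hk⟩, rfl⟩ := h
      rw [eq_of_heq hk]
    · rintro ⟨_, γ, k, m, hm, rfl⟩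
      exact ⟨⟨⟨γ, k⟩, m, hm⟩, rfl⟩
  have h := sizeSeries_congr (f := fun p => 1 + p.2.1.length)
    (g := fun w : {w // w ∈ negCode Kneg Kpos R} => w.1.length) e he (by
      intro p
      simp [e, add_comm])
  rw [languageSeries_eq_sizeSeries (negCode Kneg Kpos R), ← h,
    sizeSeries_prod (fun _ : Σ γ, Fin (Kneg γ) => 1)
      (fun w : {w // w ∈ neutralLanguage Kneg Kpos R} => w.1.length), sizeSeries_const,
    ← languageSeries_eq_sizeSeries]
  simp

theorem languageSeries_posCode :
    languageSeries (posCode Kneg Kpos R) =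
      ((∑ γ, Kpos γ : ℕ) : ℚ⟦X⟧) * X * languageSeries (neutralLanguage Kneg Kpos R) := by
  have := finite_word_fiber (neutralLanguage Kneg Kpos R)
  let e : (Σ γ, Fin (Kpos γ)) × {w // w ∈ neutralLanguage Kneg Kpos R} →
      {w // w ∈ posCode Kneg Kpos R} :=
    fun p => ⟨p.2.1 ++ [Sum.inr (DyckLoop.pos p.1.1 p.1.2)], p.1.1, p.1.2, p.2.1, p.2.2, rfl⟩
  have he : Function.Bijective e := by
    constructor
    · rintro ⟨⟨γ, k⟩, m, hm⟩ ⟨⟨γ', k'⟩, m', hm'⟩ h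
      have h := congrArg Subtype.val h
      obtain ⟨rfl, hd⟩ := List.append_inj' h rfl
      simp only [List.cons.injEq, Sum.inr.injEq, DyckLoop.pos.injEq, and_true] at hd
      obtain ⟨rfl, hk⟩ := hd
      rw [eq_of_heq hk]
    · rintro ⟨_, γ, k, m, hm, rfl⟩
      exact ⟨⟨⟨γ, k⟩, m, hm⟩, rfl⟩
  have h := sizeSeries_congr (f := fun p => 1 + p.2.1.length)
    (g := fun w : {w // w ∈ posCode Kneg Kpos R} => w.1.length) e he (by
      intro p
      simp [e, add_comm])
  rw [languageSeries_eq_sizeSeries (posCode Kneg Kpos R), ← h,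
    sizeSeries_prod (fun _ : Σ γ, Fin (Kpos γ) => 1)
      (fun w : {w // w ∈ neutralLanguage Kneg Kpos R} => w.1.length), sizeSeries_const,
    ← languageSeries_eq_sizeSeries]
  simp

theorem languageSeries_balancedCode :
    languageSeries (balancedCode Kneg Kpos R) =
      ((∑ γ, Kneg γ * Kpos γ : ℕ) : ℚ⟦X⟧) * X ^ 2 *
        languageSeries (neutralLanguage Kneg Kpos R) * languageSeries R := by
  have := finite_word_fiber (neutralLanguage Kneg Kpos R)
  have := finite_word_fiber R
  have := finite_prod_fiber (fun _ : Σ γ, Fin (Kneg γ) × Fin (Kpos γ) => 2)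
    (fun w : {w // w ∈ neutralLanguage Kneg Kpos R} => w.1.length)
  let e : ((Σ γ, Fin (Kneg γ) × Fin (Kpos γ)) × {w // w ∈ neutralLanguage Kneg Kpos R}) ×
      {r // r ∈ R} → {w // w ∈ balancedCode Kneg Kpos R} :=
    fun p => ⟨_, p.1.1.1, p.1.1.2.1, p.1.1.2.2, p.1.2.1, p.2.1, p.1.2.2, p.2.2, rfl⟩
  have he : Function.Bijective e := by
    constructor
    · rintro ⟨⟨⟨γ, k1, k2⟩, m, hm⟩, r, hr⟩ ⟨⟨⟨γ', k1', k2'⟩, m', hm'⟩, r', hr'⟩ h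
      have h := congrArg Subtype.val h
      simp only [e, List.cons.injEq, Sum.inr.injEq, DyckLoop.neg.injEq] at h
      obtain ⟨⟨rfl, h1⟩, h2⟩ := h
      obtain ⟨rfl, h3, rfl⟩ := append_inr_cons_inj h2
      simp only [DyckLoop.pos.injEq, heq_eq_eq, true_and] at h3
      rw [eq_of_heq h1, h3]
    · rintro ⟨_, γ, k, k', m, r, hm, hr, rfl⟩
      exact ⟨⟨⟨⟨γ, k, k'⟩, m, hm⟩, r, hr⟩, rfl⟩
  have h := sizeSeries_congr (f := fun p => 2 + p.1.2.1.length + p.2.1.length)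
    (g := fun w : {w // w ∈ balancedCode Kneg Kpos R} => w.1.length) e he (by
      intro p
      simp only [e, List.length_cons, List.length_append, List.length_map]
      omega)
  rw [languageSeries_eq_sizeSeries (balancedCode Kneg Kpos R), ← h,
    sizeSeries_prod (fun p : (Σ γ, Fin (Kneg γ) × Fin (Kpos γ)) ×
      {w // w ∈ neutralLanguage Kneg Kpos R} => 2 + p.2.1.length)
      (fun r : {r // r ∈ R} => r.1.length),
    sizeSeries_prod (fun _ : Σ γ, Fin (Kneg γ) × Fin (Kpos γ) => 2)
      (fun w : {w // w ∈ neutralLanguage Kneg Kpos R} => w.1.length), sizeSeries_const,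
    ← languageSeries_eq_sizeSeries, ← languageSeries_eq_sizeSeries]
  simp

/-- A neutral word is uniquely a word of `R` followed by balanced codewords, as each of these starts
with a loop. Circularity turns the series of the star into `1 / (1 - c)`. -/
theorem languageSeries_neutralLanguage (h0 : [] ∈ R) :
    languageSeries (neutralLanguage Kneg Kpos R) *
      (1 - languageSeries (balancedCode Kneg Kpos R)) = languageSeries R := by
  have := finite_word_fiber R
  have := finite_word_fiber (balancedCode Kneg Kpos R)∗
  let e : {r // r ∈ R} × {w // w ∈ (balancedCode Kneg Kpos R)∗} →
      {w // w ∈ neutralLanguage Kneg Kpos R} :=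
    fun p => ⟨p.1.1.map Sum.inl ++ p.2.1, (Neutral.base _ p.1.2).append_kstar_balanced p.2.2⟩
  have key : ∀ {r r' : List S} {c : List (S ⊕ DyckLoop Kneg Kpos)},
      c ∈ (balancedCode Kneg Kpos R)∗ → ∀ z, r'.map Sum.inl = r.map Sum.inl ++ z →
      ∀ c', c = z ++ c' → z = [] := by
    intro r r' c hc z hz c' hcz
    obtain ⟨-, z', -, -, rfl⟩ := List.map_eq_append_iff.1 hz
    cases z' with
    | nil => rfl
    | cons s z' => exact (head_of_mem_kstar_balanced hc _ _ hcz).elim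
  have hinj := List.map_injective_iff.2 (Sum.inl_injective (α := S) (β := DyckLoop Kneg Kpos))
  have he : Function.Bijective e := by
    constructor
    · rintro ⟨⟨r, hr⟩, c, hc⟩ ⟨⟨r', hr'⟩, c', hc'⟩ h
      have h := congrArg Subtype.val h
      simp only [e] at h
      rcases List.append_eq_append_iff.1 h with ⟨z, h1, h2⟩ | ⟨z, h1, h2⟩
      · obtain rfl := key hc z h1 c' h2
        rw [List.append_nil] at h1
        obtain rfl := hinj h1
        obtain rfl : c = c' := h2
        rfl
      · obtain rfl := key hc' z h1 c h2
        rw [List.append_nil] at h1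
        obtain rfl := hinj h1
        obtain rfl : c' = c := h2
        rfl
    · rintro ⟨w, hw⟩
      obtain ⟨r, hr, c, hc, rfl⟩ := Neutral.exists_eq_append_balanced hw
      exact ⟨⟨⟨r, hr⟩, c, hc⟩, rfl⟩
  have h := sizeSeries_congr (f := fun p => p.1.1.length + p.2.1.length)
    (g := fun w : {w // w ∈ neutralLanguage Kneg Kpos R} => w.1.length) e he (by
      intro p
      simp [e])
  rw [languageSeries_eq_sizeSeries (neutralLanguage Kneg Kpos R), ← h,
    sizeSeries_prod (fun r : {r // r ∈ R} => r.1.length)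
      (fun w : {w // w ∈ (balancedCode Kneg Kpos R)∗} => w.1.length),
    ← languageSeries_eq_sizeSeries, ← languageSeries_eq_sizeSeries, mul_assoc,
    (isCircularCode_balancedCode h0).languageSeries_kstar, mul_one]

end Counting

/-! ### Return paths and the determinant formula -/

namespace LabeledGraph
variable {V E S : Type*} {G : LabeledGraph V E S}

theorem RightResolving.eq_of_map_label_eq (hres : G.RightResolving) {u w w' : V}
    {p p' : List E} (hp : G.IsPath u p w) (hp' : G.IsPath u p' w')
    (h : p.map G.label = p'.map G.label) : p = p' := by
  induction p generalizing u p' with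
  | nil =>
    cases p' with
    | nil => rfl
    | cons e p' => simp at h
  | cons e p ih =>
    cases p' with
    | nil => simp at h
    | cons e' p' =>
      simp only [List.map_cons, List.cons.injEq] at h
      obtain rfl := hres e e' (hp.1.trans hp'.1.symm) h.1
      rw [ih hp.2 hp'.2 h.2]

theorem RightResolving.languageSeries_returnLabels (hres : G.RightResolving) (v : V) :
    languageSeries (G.returnLabels v) = languageSeries (G.returnPaths v) := by
  rw [languageSeries_eq_sizeSeries, languageSeries_eq_sizeSeries]
  symm
  refine sizeSeries_congr (fun p => ⟨p.1.map G.label, p.1, p.2, rfl⟩) ⟨?_, ?_⟩ (by simp)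
  · rintro ⟨p, hp⟩ ⟨p', hp'⟩ h
    exact Subtype.ext (hres.eq_of_map_label_eq hp hp' (congrArg Subtype.val h))
  · rintro ⟨_, p, hp, rfl⟩
    exact ⟨⟨p, hp⟩, rfl⟩

end LabeledGraph

/-- The adjugate entry is the determinant with row `v` replaced by a unit vector. That matrix is
block triangular with a block `1` at `v`. -/
theorem Matrix.det_submatrix_ne_eq_adjugate {V A : Type*} [Fintype V] [DecidableEq V] [CommRing A]
    (M : Matrix V V A) (v : V) :
    (M.submatrix (Subtype.val : {u : V // u ≠ v} → V) Subtype.val).det = M.adjugate v v := by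
  rw [Matrix.adjugate_apply, Matrix.twoBlockTriangular_det (M.updateRow v (Pi.single v 1))
    (fun i => i ≠ v)]
  · have h1 : ((M.updateRow v (Pi.single v 1)).toSquareBlockProp fun i => i ≠ v) =
        M.submatrix Subtype.val Subtype.val := by
      ext i j
      simp [Matrix.toSquareBlockProp_def, Matrix.updateRow_ne i.2]
    have h2 : ((M.updateRow v (Pi.single v 1)).toSquareBlockProp fun i => ¬ i ≠ v) = 1 := by
      ext ⟨i, hi⟩ ⟨j, hj⟩
      rw [not_not] at hi hj
      subst hi hj
      simp [Matrix.toSquareBlockProp_def]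
    rw [h1, h2, Matrix.det_one, mul_one]
  · intro i hi j hj
    rw [not_not] at hi
    subst hi
    rw [Matrix.updateRow_self, Pi.single_eq_of_ne hj]

namespace LabeledGraph
variable {V E S : Type*} (G : LabeledGraph V E S)

/-- The number of paths of length `n` from `u` to `w`. -/
noncomputable def pathCount (u w : V) (n : ℕ) : ℕ :=
  Nat.card {p : List E // G.IsPath u p w ∧ p.length = n}

theorem pathCount_zero [DecidableEq V] (u w : V) :
    G.pathCount u w 0 = if u = w then 1 else 0 := by
  split_ifs with h
  · subst h
    rw [pathCount, Nat.card_eq_one_iff_unique]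
    exact ⟨⟨fun a b => Subtype.ext ((List.length_eq_zero_iff.1 a.2.2).trans
      (List.length_eq_zero_iff.1 b.2.2).symm)⟩, ⟨⟨[], rfl, rfl⟩⟩⟩
  · have : IsEmpty {p : List E // G.IsPath u p w ∧ p.length = 0} := by
      refine ⟨fun p => h ?_⟩
      have := p.2.1
      rwa [List.length_eq_zero_iff.1 p.2.2] at this
    exact Nat.card_of_isEmpty

theorem pathCount_succ [Fintype V] [Finite E] (u w : V) (n : ℕ) :
    (G.pathCount u w (n + 1) : ℚ) = ∑ x, G.adjacency u x * G.pathCount x w n := by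
  have hfin : ∀ x, Finite {p : List E // G.IsPath x p w ∧ p.length = n} := fun x =>
    ((List.finite_length_eq E n).subset fun p (hp : G.IsPath x p w ∧ p.length = n) =>
      hp.2).to_subtype
  let e : {p : List E // G.IsPath u p w ∧ p.length = n + 1} ≃
      Σ x, {e : E // G.source e = u ∧ G.target e = x} ×
        {p : List E // G.IsPath x p w ∧ p.length = n} :=
    { toFun := fun p => match p with
        | ⟨e :: p, hp, hn⟩ => ⟨G.target e, ⟨e, hp.1, rfl⟩, ⟨p, hp.2, Nat.succ_injective hn⟩⟩
      invFun := fun q => ⟨q.2.1.1 :: q.2.2.1,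
        ⟨q.2.1.2.1, by rw [q.2.1.2.2]; exact q.2.2.2.1⟩, congrArg Nat.succ q.2.2.2.2⟩
      left_inv := by
        rintro ⟨_ | ⟨e, p⟩, hp, hn⟩
        · simp at hn
        · rfl
      right_inv := by
        rintro ⟨x, ⟨e, he, rfl⟩, ⟨p, hp, hn⟩⟩
        rfl }
  rw [pathCount, Nat.card_congr e, Nat.card_sigma]
  push_cast
  refine Finset.sum_congr rfl fun x _ => ?_
  rw [Nat.card_prod]
  push_cast
  rfl

/-- The matrix of the generating functions of the numbers of paths. -/
noncomputable def pathMatrix : Matrix V V ℚ⟦X⟧ :=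
  Matrix.of fun u w => PowerSeries.mk fun n => (G.pathCount u w n : ℚ)

/-- A path is empty or an edge followed by a path, so the path matrix `P` satisfies `P = 1 + X A P`.
-/
theorem oneSubAdjacency_mul_pathMatrix [Fintype V] [DecidableEq V] [Finite E] :
    G.oneSubAdjacency * G.pathMatrix = 1 := by
  have h : G.pathMatrix = 1 + (X : ℚ⟦X⟧) •
      (G.adjacency.map (PowerSeries.C : ℚ →+* ℚ⟦X⟧) * G.pathMatrix) := by
    ext u w n
    rw [Matrix.add_apply, Matrix.smul_apply, Matrix.mul_apply, map_add, smul_eq_mul,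
      Matrix.one_apply]
    cases n with
    | zero =>
      rw [PowerSeries.coeff_zero_X_mul]
      simp only [pathMatrix, Matrix.of_apply, PowerSeries.coeff_mk, pathCount_zero]
      split_ifs <;> simp
    | succ n =>
      rw [PowerSeries.coeff_succ_X_mul, map_sum]
      simp only [pathMatrix, Matrix.of_apply, Matrix.map_apply, PowerSeries.coeff_C_mul,
        PowerSeries.coeff_mk, pathCount_succ]
      split_ifs <;> simp
  rw [oneSubAdjacency, sub_mul, one_mul, Matrix.smul_mul]
  nth_rewrite 1 [h]
  exact add_sub_cancel_right _ _

theorem constantCoeff_det_oneSubAdjacency [Fintype V] [DecidableEq V] :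
    constantCoeff G.oneSubAdjacency.det = 1 := by
  rw [RingHom.map_det]
  have : (constantCoeff (R := ℚ)).mapMatrix G.oneSubAdjacency = 1 := by
    ext u w
    simp [oneSubAdjacency, Matrix.one_apply, apply_ite]
  rw [this, Matrix.det_one]

theorem languageSeries_returnPaths [Fintype V] [DecidableEq V] [Finite E] (v : V) :
    languageSeries (G.returnPaths v) =
      (G.oneSubAdjacency.submatrix (Subtype.val : {u : V // u ≠ v} → V) Subtype.val).det *
        G.oneSubAdjacency.det⁻¹ := by
  have hg : languageSeries (G.returnPaths v) = G.pathMatrix v v := by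
    ext n
    simp only [languageSeries, pathMatrix, Matrix.of_apply, PowerSeries.coeff_mk, pathCount]
    rfl
  rw [PowerSeries.eq_mul_inv_iff_mul_eq (by rw [constantCoeff_det_oneSubAdjacency]; norm_num), hg,
    Matrix.det_submatrix_ne_eq_adjugate]
  have h : G.oneSubAdjacency.adjugate = G.oneSubAdjacency.det • G.pathMatrix := by
    calc G.oneSubAdjacency.adjugate
        = G.oneSubAdjacency.adjugate * (G.oneSubAdjacency * G.pathMatrix) := by
          rw [oneSubAdjacency_mul_pathMatrix, mul_one]
      _ = _ := by rw [← mul_assoc, Matrix.adjugate_mul, Matrix.smul_mul, one_mul]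
  rw [h, Matrix.smul_apply, smul_eq_mul, mul_comm]

end LabeledGraph

end

/-! ### The closed form of the zeta function -/

theorem theorem2p3 {V E S Γ : Type*} [Fintype V] [DecidableEq V] [Fintype E] [Fintype S]
    [Fintype Γ] (hΓ : 1 < Fintype.card Γ)
    (G : LabeledGraph V E S) (v : V) (hirr : G.Irreducible) (hres : G.RightResolving)
    (Kneg Kpos : Γ → ℕ) (hneg : ∀ γ, 1 ≤ Kneg γ) (hpos : ∀ γ, 1 ≤ Kpos γ)
    (g Km Kp K s : ℚ⟦X⟧)
    (hg : g = languageSeries (G.returnPaths v))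
    (hKm : Km = ((∑ γ, Kneg γ : ℕ) : ℚ⟦X⟧))
    (hKp : Kp = ((∑ γ, Kpos γ : ℕ) : ℚ⟦X⟧))
    (hK : K = ((∑ γ, Kneg γ * Kpos γ : ℕ) : ℚ⟦X⟧))
    (hs : s = sqrtSeries (1 - 4 * K * g ^ 2 * X ^ 2)) :
    g = (G.oneSubAdjacency.submatrix (Subtype.val : {u : V // u ≠ v} → V) Subtype.val).det *
        G.oneSubAdjacency.det⁻¹ ∧
    zetaSeries (G.attachedShift v Kneg Kpos) =
      2 * zetaSeries G.soficShift * (1 + s) *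
        ((1 - 2 * Km * g * X + s) * (1 - 2 * Kp * g * X + s))⁻¹ := by
  refine ⟨hg.trans (G.languageSeries_returnPaths v), ?_⟩
  have h0 := G.nil_mem_returnLabels v
  have hz := zetaSeries_attachedShift (Kneg := Kneg) (Kpos := Kpos) G v
  have hM := languageSeries_neutralLanguage (Kneg := Kneg) (Kpos := Kpos) h0
  have hb := languageSeries_balancedCode (Kneg := Kneg) (Kpos := Kpos) (R := G.returnLabels v)
  rw [languageSeries_negCode, languageSeries_posCode, ← hKm, ← hKp] at hz
  rw [hres.languageSeries_returnLabels, ← hg] at hM hb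
  rw [← hK] at hb
  set c := languageSeries (balancedCode Kneg Kpos (G.returnLabels v))
  set M := languageSeries (neutralLanguage Kneg Kpos (G.returnLabels v))
  have hc : constantCoeff c = 0 := by rw [hb]; simp
  -- `hb` and `hM` give `c (1 - c) = K g² X²`, so the square of `1 - 2c` is the radicand; `c` has no
  -- constant term, which selects this root.
  have hs' : s = 1 - 2 * c := by
    rw [hs]
    symm
    apply eq_sqrtSeries
    · linear_combination (-4 * (1 - c)) * hb - 4 * K * X ^ 2 * g * hM
    · simp [hc]
  -- Here `g = (1 - c) M` lets the factor `1 - c` be pulled out of the denominator; one of the two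
  -- such factors cancels against `1 + s = 2 (1 - c)`.
  have hD1 : 1 - 2 * Km * g * X + s = 2 * (1 - c) * (1 - Km * X * M) := by
    linear_combination hs' + 2 * Km * X * hM
  have hD2 : 1 - 2 * Kp * g * X + s = 2 * (1 - c) * (1 - Kp * X * M) := by
    linear_combination hs' + 2 * Kp * X * hM
  rw [PowerSeries.eq_mul_inv_iff_mul_eq, hD1, hD2, ← hz, hs']
  · ring
  · have h2 : constantCoeff (2 : ℚ⟦X⟧) = 2 := map_ofNat _ 2
    rw [hD1, hD2]
    simp [hc, h2]
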